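/- All sets are finite; dyperedges and hyperedges may have parallel copies. A mixed hypergraph consists of a vertex set, a family $\mathcal A$ of dyperedges $a=(\mathrm{tail}(a),\mathrm{head}(a))$, where $\mathrm{head}(a)$ is a vertex and $\mathrm{tail}(a)$ is a nonempty set of vertices not containing $\mathrm{head}(a)$, and a family $\mathcal E$ of hyperedges, which are vertex sets of size at least two. It is a dypergraph if $\mathcal E=\emptyset$. A vertex $r$ is a simple root if it is not the head of any dyperedge, it belongs to no hyperedge, every dyperedge $a$ with $r\in\mathrm{tail}(a)$ has $\mathrm{tail}(a)=\{r\}$, and there is at most one such dyperedge. A simply matroid-rooted mixed hypergraph is a pair $(\mathcal H,\mathcal M)$, where $\mathcal H=(V\cup R,\mathcal A\cup\mathcal E)$ is a mixed hypergraph with $V\cap R=\emptyset$, all vertices of $R$ are simple roots, and $\mathcal M$ is a matroid on $R$ with rank function $r_{\mathcal M}$. The directed extension $\mathcal D_{\mathcal H}=(V\cup R,\mathcal A\cup\mathcal A_{\mathcal E})$ is the dypergraph obtained from $\mathcal H$ by replacing each hyperedge $e$ by its bundle $\mathcal A_e=\{(e-v,v):v\in e\}$ (bundles of different hyperedges are disjoint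 from each other and from $\mathcal A$, as families). Trimming a dyperedge $a$ means replacing it by an arc from some vertex of $\mathrm{tail}(a)$ to $\mathrm{head}(a)$ (tail vertices dropped in this way need not be vertices of the resulting digraph). An $r$-arborescence is a digraph containing $r$ whose underlying graph is a tree, in which no arc enters $r$ and exactly one arc enters each other vertex. A matroid-based packing of hyperarborescences in $(\mathcal D_{\mathcal H},\mathcal M)$ is a family $(\mathcal B_r)_{r\in R}$ of pairwise disjoint sets of dyperedges of $\mathcal D_{\mathcal H}$ such that each $\mathcal B_r$ can be trimmed to an $r$-arborescence $B_r$ in such a way that for every $v\in V$ the set $\{r\in R: v\in V(B_r)\}$ is a basis of $\mathcal M$. Its dyperedge set is $\bigcup_{r\in R}\mathcal B_r$; the packing is feasible if its dyperedge set contains at most one element of $\mathcal A_e$ for each $e\in\mathcal E$. For $\mathcal Z\subseteq\mathcal A\cup\mathcal E$ let $V_{\mathcal Z}$ be the set of vertices of $V$ incident to an element of $\mathcal Z$ and $R_{\mathcal Z}$ the set of vertices of $R$ incident to a dyperedge in $\mathcal Z$, and let $b(\mathcal Z)=r_{\mathcal M}(R)(|V_{\mathcal Z}|-1)+r_{\mathcal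 M}(R_{\mathcal Z})$. The Tanigawa matroid is the matroid on $\mathcal A\cup\mathcal E$ whose independent sets are the sets $\mathcal X$ such that $|\mathcal Y|\le b(\mathcal Y)$ for all nonempty $\mathcal Y\subseteq\mathcal X$. The extended Tanigawa matroid $\mathcal T^{ex}_{(\mathcal H,\mathcal M)}$ is the matroid on $\mathcal A\cup\mathcal A_{\mathcal E}$ obtained from it by replacing each $e\in\mathcal E$ by $|e|$ parallel copies of $e$, identified with the elements of $\mathcal A_e$. For $k\in\mathbb Z_{\ge 0}$ the entering matroid $\mathcal M^{\oplus}_{(\mathcal D_{\mathcal H},k)}$ is the direct sum, over all $v\in V$, of the uniform matroids of rank $k$ on the set of dyperedges of $\mathcal D_{\mathcal H}$ with head $v$. Theorem. Let $(\mathcal H=(V\cup R,\mathcal A\cup\mathcal E),\mathcal M)$ be a simply matroid-rooted mixed hypergraph and $k=r_{\mathcal M}(R)$. Then the dyperedge sets of the feasible matroid-based packings of hyperarborescences in $(\mathcal D_{\mathcal H},\mathcal M)$ are exactly the common independent sets of size $k|V|$ of $\mathcal T^{ex}_{(\mathcal H,\mathcal M)}$ and $\mathcal M^{\oplus}_{(\mathcal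 D_{\mathcal H},k)}$. -/

import Mathlib

open Set

/-! ### Matroids from submodular functions, and uniform matroids -/

theorem submodular_augment {S : Type*} [Finite S] (b : Set S → ℤ)
    (mono : ∀ X Y, X ⊆ Y → b X ≤ b Y)
    (submod : ∀ X Y, b (X ∪ Y) + b (X ∩ Y) ≤ b X + b Y)
    {I J : Set S} (hI : ∀ Y ⊆ I, Y.Nonempty → (Y.ncard : ℤ) ≤ b Y)
    (hJ : ∀ Y ⊆ J, Y.Nonempty → (Y.ncard : ℤ) ≤ b Y) (hIJ : I.ncard < J.ncard) :
    ∃ e ∈ J, e ∉ I ∧ ∀ Y ⊆ insert e I, Y.Nonempty → (Y.ncard : ℤ) ≤ b Y := by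
  classical
  have := Fintype.ofFinite S
  by_contra! hcon
  let P : S → Set S → Prop := fun e t =>
    t ⊆ I ∧ t.Nonempty ∧ b t ≤ t.ncard ∧ b (insert e t) ≤ b t
  have hex : ∀ e ∈ J, e ∉ I → ∃ t, Maximal (P e) t := by
    intro e heJ heI
    obtain ⟨Y, hYI, hYne, hY⟩ := hcon e heJ heI
    have heY : e ∈ Y := by
      by_contra heY
      have := hI Y ((subset_insert_iff_of_notMem heY).1 hYI) hYne
      omega
    have hsub : Y \ {e} ⊆ I := by
      rintro x ⟨hx, hxe⟩
      exact (hYI hx).resolve_left hxe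
    have hcard : (Y \ {e}).ncard + 1 = Y.ncard := ncard_sdiff_singleton_add_one heY (toFinite Y)
    have hle : b (Y \ {e}) ≤ b Y := mono _ _ sdiff_subset
    have hins : insert e (Y \ {e}) = Y := insert_sdiff_self_of_mem heY
    have hne : (Y \ {e}).Nonempty := by
      by_contra hne
      rw [not_nonempty_iff_eq_empty] at hne
      rw [hne] at hins hcard
      have h1 := hJ {e} (by simpa using heJ) (singleton_nonempty e)
      have h2 : ({e} : Set S) = Y := by simpa using hins
      rw [h2] at h1
      omega
    have h3 := hI _ hsub hne
    have hP : P e (Y \ {e}) := ⟨hsub, hne, by omega, by rw [hins]; omega⟩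
    obtain ⟨t, -, ht⟩ := (toFinite {t | P e t}).exists_le_maximal hP
    exact ⟨t, ht⟩
  choose! T hT using hex
  have key : ∀ e ∈ J, e ∉ I → ∀ e' ∈ J, e' ∉ I → (T e ∩ T e').Nonempty → T e' ⊆ T e := by
    intro e heJ heI e' heJ' heI' hne
    obtain ⟨h1, h2, h3, h4⟩ := (hT e heJ heI).prop
    obtain ⟨h1', h2', h3', h4'⟩ := (hT e' heJ' heI').prop
    have hsm := submod (T e) (T e')
    have hc := hI _ (inter_subset_left.trans h1) hne
    have hcard := ncard_union_add_ncard_inter (T e) (T e')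
    have hsm2 := submod (T e ∪ T e') (insert e (T e))
    have hm1 : b (T e) ≤ b ((T e ∪ T e') ∩ insert e (T e)) :=
      mono _ _ (subset_inter subset_union_left (subset_insert _ _))
    have hm2 : b (insert e (T e ∪ T e')) ≤ b ((T e ∪ T e') ∪ insert e (T e)) :=
      mono _ _ (insert_subset (Or.inr (mem_insert _ _)) subset_union_left)
    have hP : P e (T e ∪ T e') :=
      ⟨union_subset h1 h1', h2.mono subset_union_left, by omega, by omega⟩
    exact subset_union_right.trans ((hT e heJ heI).le_of_ge hP subset_union_left)
  obtain ⟨F, hFdef⟩ : ∃ F : Finset S, F = (J \ I).toFinset := ⟨_, rfl⟩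
  have hF : ∀ e ∈ F, e ∈ J ∧ e ∉ I := fun e he => by simpa [hFdef] using he
  have hfib : ∀ t ∈ F.image T, (F.filter (fun e => T e = t)).card ≤ (t \ J).ncard := by
    intro t ht
    obtain ⟨e₀, he₀, rfl⟩ := Finset.mem_image.1 ht
    obtain ⟨h1, h2, h3, h4⟩ := (hT e₀ (hF _ he₀).1 (hF _ he₀).2).prop
    set t := T e₀ with htdef
    have habs : ∀ G : Finset S, (∀ e ∈ G, b (insert e t) ≤ b t) → b (t ∪ G) ≤ b t := by
      intro G
      induction G using Finset.induction_on with
      | empty => simp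
      | insert a G ha ih =>
        intro h
        have i1 := ih fun e he => h e (Finset.mem_insert_of_mem he)
        have i2 := h a (Finset.mem_insert_self _ _)
        have i3 := submod (t ∪ G) (insert a t)
        have i4 : b t ≤ b ((t ∪ G) ∩ insert a t) :=
          mono _ _ (subset_inter subset_union_left (subset_insert _ _))
        have i5 : b (t ∪ ↑(insert a G)) ≤ b ((t ∪ G) ∪ insert a t) := by
          apply mono
          rw [Finset.coe_insert]
          intro x hx
          simp only [mem_union, mem_insert_iff] at hx ⊢
          tauto
        omega
    set G := F.filter (fun e => T e = t) with hG
    have hGT : b (t ∪ G) ≤ b t := by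
      apply habs
      intro e he
      rw [hG, Finset.mem_filter] at he
      have := (hT e (hF _ he.1).1 (hF _ he.1).2).prop.2.2.2
      rwa [he.2] at this
    have hGJ : (G : Set S) ⊆ J := fun e he => by
      rw [hG, Finset.mem_coe, Finset.mem_filter] at he
      exact (hF _ he.1).1
    have he₀G : e₀ ∈ G := by rw [hG, Finset.mem_filter]; exact ⟨he₀, rfl⟩
    have hdis : Disjoint (t ∩ J) (G : Set S) := by
      rw [Set.disjoint_left]
      intro x hx hxG
      rw [hG, Finset.mem_coe, Finset.mem_filter] at hxG
      exact (hF _ hxG.1).2 (h1 hx.1)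
    have j1 := hJ ((t ∩ J) ∪ G) (union_subset inter_subset_right hGJ) ⟨e₀, Or.inr he₀G⟩
    have j2 : b ((t ∩ J) ∪ G) ≤ b (t ∪ G) := mono _ _ (union_subset_union_left _ inter_subset_left)
    have j3 := ncard_union_eq hdis
    have j4 := ncard_inter_add_ncard_sdiff_eq_ncard t J
    rw [ncard_coe_finset] at j3
    omega
  have hsum : F.card ≤ ∑ t ∈ F.image T, (t \ J).ncard := by
    rw [Finset.card_eq_sum_card_image T F]
    exact Finset.sum_le_sum hfib
  have hdisj : ∑ t ∈ F.image T, (t \ J).ncard ≤ (I \ J).ncard := by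
    have e1 : ∑ t ∈ F.image T, (t \ J).ncard = ∑ t ∈ F.image T, (t \ J).toFinset.card :=
      Finset.sum_congr rfl fun t _ => ncard_eq_toFinset_card' _
    rw [e1, ncard_eq_toFinset_card', ← Finset.card_biUnion]
    · apply Finset.card_le_card
      intro x hx
      simp only [Finset.mem_biUnion, Finset.mem_image, mem_toFinset] at hx ⊢
      obtain ⟨_, ⟨e, he, rfl⟩, hx⟩ := hx
      exact ⟨(hT e (hF _ he).1 (hF _ he).2).prop.1 hx.1, hx.2⟩
    · intro t ht t' ht' hne
      obtain ⟨e, he, rfl⟩ := Finset.mem_image.1 ht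
      obtain ⟨e', he', rfl⟩ := Finset.mem_image.1 ht'
      change Disjoint (T e \ J).toFinset (T e' \ J).toFinset
      rw [Set.disjoint_toFinset, Set.disjoint_left]
      intro x hx hx'
      exact hne (subset_antisymm
        (key _ (hF _ he').1 (hF _ he').2 _ (hF _ he).1 (hF _ he).2 ⟨x, hx'.1, hx.1⟩)
        (key _ (hF _ he).1 (hF _ he).2 _ (hF _ he').1 (hF _ he').2 ⟨x, hx.1, hx'.1⟩))
  have k1 := ncard_inter_add_ncard_sdiff_eq_ncard I J
  have k2 := ncard_inter_add_ncard_sdiff_eq_ncard J I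
  have k3 : F.card = (J \ I).ncard := by rw [hFdef, ncard_eq_toFinset_card']
  rw [inter_comm] at k2
  omega

/-- The matroid on a finite set `S` induced by a monotone submodular function `b`: a set is
independent iff each of its nonempty subsets `Y` satisfies `|Y| ≤ b Y`. -/
def submodularMatroid {S : Type*} [Finite S] (b : Set S → ℤ)
    (mono : ∀ X Y, X ⊆ Y → b X ≤ b Y)
    (submod : ∀ X Y, b (X ∪ Y) + b (X ∩ Y) ≤ b X + b Y) : Matroid S :=
  (IndepMatroid.ofFinite (E := univ) (toFinite _)
    (fun I => ∀ Y ⊆ I, Y.Nonempty → (Y.ncard : ℤ) ≤ b Y)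
    (fun _ hY hne => absurd (subset_empty_iff.1 hY) hne.ne_empty)
    (fun _ _ hJ hIJ Y hY hne => hJ Y (hY.trans hIJ) hne)
    (fun _ _ hI hJ hlt => submodular_augment b mono submod hI hJ hlt)
    (fun _ _ => subset_univ _)).matroid

/-- The uniform matroid of rank `k` on the ground set `E` (of rank `|E|` if `|E| < k`). -/
def uniformMatroid {S : Type*} [Finite S] (E : Set S) (k : ℕ) : Matroid S :=
  (IndepMatroid.ofFinite (E := E) (toFinite _)
    (fun I => I ⊆ E ∧ I.ncard ≤ k)
    (by simp)
    (fun _ _ hJ hIJ => ⟨hIJ.trans hJ.1, (ncard_le_ncard hIJ).trans hJ.2⟩)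
    (fun I J hI hJ hlt => by
      obtain ⟨e, heJ, heI⟩ := exists_mem_notMem_of_ncard_lt_ncard hlt
      refine ⟨e, heJ, heI, insert_subset (hJ.1 heJ) hI.1, ?_⟩
      rw [ncard_insert_of_notMem heI]
      have := hJ.2
      omega)
    (fun _ hI => hI.1)).matroid

/-- The rank of a set in a matroid, as a natural number; it is used on finite types only. -/
noncomputable def Matroid.natRk {S : Type*} (M : Matroid S) (X : Set S) : ℕ := (M.eRk X).toNat

/-! ### Arborescences -/

/-- A digraph with vertices in `W` and arcs labelled by elements of `ι` (so parallel arcs are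
possible). Only the values of `src` and `tgt` on `arcs` are relevant. -/
structure ArcDigraph (W ι : Type*) where
  verts : Set W
  arcs : Set ι
  src : ι → W
  tgt : ι → W
  src_mem : ∀ a ∈ arcs, src a ∈ verts
  tgt_mem : ∀ a ∈ arcs, tgt a ∈ verts

namespace ArcDigraph

variable {W ι : Type*}

/-- The underlying undirected graph. -/
def underlying (B : ArcDigraph W ι) : SimpleGraph B.verts :=
  SimpleGraph.fromRel fun u v => ∃ a ∈ B.arcs, B.src a = u ∧ B.tgt a = v

/-- `B` is an `r`-arborescence: its underlying graph is a tree, no arc enters `r`, and exactly one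
arc enters each other vertex. -/
structure IsArborescence (B : ArcDigraph W ι) (r : W) : Prop where
  root_mem : r ∈ B.verts
  isTree : B.underlying.IsTree
  root_not_entered : ∀ a ∈ B.arcs, B.tgt a ≠ r
  existsUnique_arc : ∀ v ∈ B.verts, v ≠ r → ∃! a, a ∈ B.arcs ∧ B.tgt a = v

end ArcDigraph

/-! ### Dypergraphs and mixed hypergraphs -/

/-- A directed hypergraph with vertex set `W` and dyperedges labelled by `ι`. -/
structure Dypergraph (W ι : Type*) where
  tail : ι → Set W
  head : ι → W
  tail_nonempty : ∀ a, (tail a).Nonempty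
  head_notMem_tail : ∀ a, head a ∉ tail a

/-- A mixed hypergraph with vertex set `W`, dyperedges labelled by `ι` and hyperedges (vertex sets
with at least two elements) labelled by `κ`. -/
structure MixedHypergraph (W ι κ : Type*) extends Dypergraph W ι where
  edge : κ → Set W
  edge_nontrivial : ∀ e, (edge e).Nontrivial

namespace Dypergraph

variable {W ι : Type*} (D : Dypergraph W ι)

/-- The dyperedges entering the vertex set `X`. -/
def entering (X : Set W) : Set ι := {a | D.head a ∈ X ∧ (D.tail a \ X).Nonempty}

/-- The dyperedges leaving the vertex set `X`. -/
def leaving (X : Set W) : Set ι := D.entering Xᶜ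

/-- The digraph `B` is obtained by trimming the dyperedges in `F`: each `a ∈ F` is replaced by an
arc from a vertex of its tail to its head. The vertex set of `B` need not contain the tail vertices
dropped in this way. -/
def IsTrimming (F : Set ι) (B : ArcDigraph W ι) : Prop :=
  B.arcs = F ∧ ∀ a ∈ F, B.src a ∈ D.tail a ∧ B.tgt a = D.head a

/-- A family of dyperedge sets indexed by the ground set of `M` (the set of roots) is a
matroid-based packing of hyperarborescences: the sets are pairwise disjoint and the `r`-th one can
be trimmed to an `r`-arborescence `B r`, such that, for each vertex `v` that is not a root, the
roots `r` with `v ∈ V(B r)` form a basis of `M`. -/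
def IsMatroidBasedPacking (M : Matroid W) (F : M.E → Set ι) : Prop :=
  Pairwise (Function.onFun Disjoint F) ∧
    ∃ B : M.E → ArcDigraph W ι,
      (∀ r, D.IsTrimming (F r) (B r) ∧ (B r).IsArborescence r) ∧
      ∀ v ∉ M.E, M.IsBase {r | ∃ h : r ∈ M.E, v ∈ (B ⟨r, h⟩).verts}

theorem entering_singleton_disjoint (R : Set W) (k : ℕ) [Finite ι] :
    Pairwise (Function.onFun Disjoint fun v : (Rᶜ : Set W) =>
      (uniformMatroid (D.entering {(v : W)}) k).E) := by
  intro v w hvw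
  change Disjoint (D.entering {(v : W)}) (D.entering {(w : W)})
  rw [Set.disjoint_left]
  intro a ha hb
  exact hvw (Subtype.ext (ha.1.symm.trans hb.1))

/-- The entering matroid of a dypergraph with root set `R`: the direct sum over all vertices
`v ∉ R` of the uniform matroids of rank `k` on the dyperedges entering `v`. -/
def enteringMatroid [Finite ι] (R : Set W) (k : ℕ) : Matroid ι :=
  Matroid.disjointSigma (fun v : (Rᶜ : Set W) => uniformMatroid (D.entering {(v : W)}) k)
    (D.entering_singleton_disjoint R k)

end Dypergraph

namespace MixedHypergraph

variable {W ι κ : Type*} (H : MixedHypergraph W ι κ)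

/-- The hyperedges entering the vertex set `X`. -/
def edgesEntering (X : Set W) : Set κ := {e | (H.edge e ∩ X).Nonempty ∧ (H.edge e \ X).Nonempty}

/-- `r` is a root: nothing enters `r`, and each dyperedge leaving `r` has tail `{r}`. -/
structure IsRoot (r : W) : Prop where
  entering_eq : H.entering {r} = ∅
  edgesEntering_eq : H.edgesEntering {r} = ∅
  tail_eq : ∀ a ∈ H.leaving {r}, H.tail a = {r}

/-- A simple root: at most one dyperedge leaves it. -/
structure IsSimpleRoot (r : W) : Prop extends H.IsRoot r where
  leaving_le : (H.leaving {r}).encard ≤ 1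

/-- `H` is a simply rooted mixed hypergraph with root set `R` (and `V = Rᶜ`). -/
def IsSimplyRooted (R : Set W) : Prop := ∀ r ∈ R, H.IsSimpleRoot r

/-- The directed extension: every hyperedge `e` is replaced by its bundle, the set of all its
orientations `(e - v, v)`, `v ∈ e`. -/
def directedExtension : Dypergraph W (ι ⊕ Σ e : κ, H.edge e) where
  tail := Sum.elim H.tail fun p => H.edge p.1 \ {(p.2 : W)}
  head := Sum.elim H.head fun p => p.2
  tail_nonempty := by
    rintro (a | ⟨e, v⟩)
    · exact H.tail_nonempty a
    · obtain ⟨w, hw, hne⟩ := (H.edge_nontrivial e).exists_ne v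
      exact ⟨w, hw, hne⟩
  head_notMem_tail := by
    rintro (a | ⟨e, v⟩)
    · exact H.head_notMem_tail a
    · simp

/-- The bundle of the hyperedge `e`. -/
def bundle (e : κ) : Set (ι ⊕ Σ e : κ, H.edge e) := Set.range fun v : H.edge e => Sum.inr ⟨e, v⟩

/-- A packing in the directed extension is feasible if altogether it contains at most one dyperedge
of each bundle. -/
def IsFeasible {R : Set W} (F : R → Set (ι ⊕ Σ e : κ, H.edge e)) : Prop :=
  ∀ e, ((⋃ r, F r) ∩ H.bundle e).encard ≤ 1

/-- The vertices incident to a given dyperedge or hyperedge. -/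
def ends : ι ⊕ κ → Set W := Sum.elim (fun a => insert (H.head a) (H.tail a)) H.edge

/-- The vertices in `Rᶜ` incident to an element of `Z`. -/
def incidentVertices (R : Set W) (Z : Set (ι ⊕ κ)) : Set W := {v | v ∉ R ∧ ∃ z ∈ Z, v ∈ H.ends z}

/-- The vertices in `R` incident to a dyperedge in `Z`. -/
def incidentRoots (R : Set W) (Z : Set (ι ⊕ κ)) : Set W :=
  {r | r ∈ R ∧ ∃ a : ι, Sum.inl a ∈ Z ∧ r ∈ H.ends (Sum.inl a)}

/-- `b Z = r(R) (|V_Z| - 1) + r(R_Z)`, where `R` is the ground set of `M`. -/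
noncomputable def tanigawaFun (M : Matroid W) (Z : Set (ι ⊕ κ)) : ℤ :=
  (M.natRk M.E : ℤ) * ((H.incidentVertices M.E Z).ncard - 1) + M.natRk (H.incidentRoots M.E Z)

theorem incidentVertices_mono (R : Set W) {X Y : Set (ι ⊕ κ)} (h : X ⊆ Y) :
    H.incidentVertices R X ⊆ H.incidentVertices R Y :=
  fun _ ⟨hv, z, hz, hvz⟩ => ⟨hv, z, h hz, hvz⟩

theorem incidentRoots_mono (R : Set W) {X Y : Set (ι ⊕ κ)} (h : X ⊆ Y) :
    H.incidentRoots R X ⊆ H.incidentRoots R Y :=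
  fun _ ⟨hv, a, ha, hva⟩ => ⟨hv, a, h ha, hva⟩

theorem natRk_coe [Finite W] (M : Matroid W) (X : Set W) : (M.natRk X : ℕ∞) = M.eRk X :=
  ENat.natCast_toNat (ne_top_of_le_ne_top (toFinite X).encard_lt_top.ne (M.eRk_le_encard X))

theorem natRk_mono [Finite W] (M : Matroid W) {X Y : Set W} (h : X ⊆ Y) :
    M.natRk X ≤ M.natRk Y := by
  have := M.eRk_mono h
  rw [← natRk_coe, ← natRk_coe] at this
  exact_mod_cast this

theorem natRk_submod [Finite W] (M : Matroid W) (X Y : Set W) :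
    M.natRk (X ∩ Y) + M.natRk (X ∪ Y) ≤ M.natRk X + M.natRk Y := by
  have := M.eRk_submod X Y
  simp only [← natRk_coe] at this
  exact_mod_cast this

theorem tanigawaFun_mono [Finite W] (M : Matroid W) (X Y : Set (ι ⊕ κ)) (h : X ⊆ Y) :
    H.tanigawaFun M X ≤ H.tanigawaFun M Y := by
  have h1 := ncard_le_ncard (H.incidentVertices_mono M.E h)
  have h2 := natRk_mono M (H.incidentRoots_mono M.E h)
  unfold tanigawaFun
  gcongr

theorem tanigawaFun_submod [Finite W] (M : Matroid W) (X Y : Set (ι ⊕ κ)) :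
    H.tanigawaFun M (X ∪ Y) + H.tanigawaFun M (X ∩ Y) ≤ H.tanigawaFun M X + H.tanigawaFun M Y := by
  have hV : H.incidentVertices M.E (X ∪ Y)
      = H.incidentVertices M.E X ∪ H.incidentVertices M.E Y := by
    ext v; simp only [incidentVertices, mem_union, mem_ofPred_eq]; grind
  have hR : H.incidentRoots M.E (X ∪ Y) = H.incidentRoots M.E X ∪ H.incidentRoots M.E Y := by
    ext v; simp only [incidentRoots, mem_union, mem_ofPred_eq]; grind
  have h1 := ncard_union_add_ncard_inter (H.incidentVertices M.E X) (H.incidentVertices M.E Y)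
  have h2 := ncard_le_ncard (subset_inter
    (H.incidentVertices_mono M.E (inter_subset_left : X ∩ Y ⊆ X))
    (H.incidentVertices_mono M.E (inter_subset_right : X ∩ Y ⊆ Y)))
  have h3 := natRk_submod M (H.incidentRoots M.E X) (H.incidentRoots M.E Y)
  have h4 := natRk_mono M (subset_inter
    (H.incidentRoots_mono M.E (inter_subset_left : X ∩ Y ⊆ X))
    (H.incidentRoots_mono M.E (inter_subset_right : X ∩ Y ⊆ Y)))
  unfold tanigawaFun
  rw [hV, hR]
  have h5 : ((H.incidentVertices M.E X ∪ H.incidentVertices M.E Y).ncard : ℤ)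
      + (H.incidentVertices M.E (X ∩ Y)).ncard
      ≤ (H.incidentVertices M.E X).ncard + (H.incidentVertices M.E Y).ncard := by
    omega
  have h6 := mul_le_mul_of_nonneg_left h5 (Int.natCast_nonneg (M.natRk M.E))
  zify at h3 h4
  linarith

/-- The Tanigawa matroid on the set of all dyperedges and hyperedges. -/
noncomputable def tanigawaMatroid [Finite W] [Finite ι] [Finite κ] (M : Matroid W) :
    Matroid (ι ⊕ κ) :=
  submodularMatroid (H.tanigawaFun M) (H.tanigawaFun_mono M) (H.tanigawaFun_submod M)

/-- The extended Tanigawa matroid: every hyperedge `e` of the Tanigawa matroid is replaced by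
parallel copies, one for each element of its bundle. (In a `comap`, the fibres of the map are
classes of parallel copies.) -/
noncomputable def extendedTanigawaMatroid [Finite W] [Finite ι] [Finite κ] (M : Matroid W) :
    Matroid (ι ⊕ Σ e : κ, H.edge e) :=
  (H.tanigawaMatroid M).comap (Sum.map id Sigma.fst)

end MixedHypergraph

/-! ### Rank and closure -/

namespace Matroid

variable {S : Type*} (M : Matroid S)

/-! Let k be the rank of `M`, and let V be the set of nonroot vertices. Independence in the extended
Tanigawa matroid splits into feasibility (at most one element per bundle) and the count |Z| + k ≤
k|V_Z| + r(R_Z) for every nonempty Z ⊆ A. A set of size k|V| that is independent in the entering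
matroid has exactly k dyperedges at each head. So the claim is that A is the dyperedge set of a
packing iff every head has in-degree k and the count holds.

Necessity (`ncard_add_natRk_le`): the dyperedges of a packing correspond bijectively to pairs (v, r)
with v in the arborescence of r, and V_Z carries k|V_Z| such pairs. Fix the head v₀ of a member of
Z. For each root r at v₀ outside R_Z, some pair (x, r) with x in V_Z does not come from Z;
otherwise, following arcs backwards from v₀ would never leave V_Z and never reach r. At least k -
r(R_Z) pairs are thus missed.

Sufficiency (`exists_isMatroidBasedPacking`): the root dyperedges place an independent set P v of
roots at each vertex v. Count and in-degrees together give the cut condition k ≤ r(P(X)) + (number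
of nonroot dyperedges entering X). Uncrossing tight sets trims these dyperedges to arcs while
preserving the condition (`exists_trimming_covering`). The sets P v then grow to bases one root
along one arc at a time; another uncrossing argument shows that a safe arc exists as long as any arc
can transport a new root (`exists_extendable_arc`). -/

theorem natRk_closure (X : Set S) : M.natRk (M.closure X) = M.natRk X := by
  rw [natRk, eRk_closure_eq, natRk]

theorem natRk_le_of_subset_closure [Finite S] {X Y : Set S} (h : X ⊆ M.closure Y) :
    M.natRk X ≤ M.natRk Y :=
  (MixedHypergraph.natRk_mono M h).trans (M.natRk_closure Y).le

theorem natRk_lt_of_mem_closure [Finite S] {X Y : Set S} {s : S} (hXY : X ⊆ M.closure Y)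
    (hs : s ∈ M.closure Y) (hsX : s ∉ M.closure X) : M.natRk X < M.natRk Y := by
  have h1 := eRk_insert_eq_add_one ⟨M.closure_subset_ground _ hs, hsX⟩
  rw [← MixedHypergraph.natRk_coe, ← MixedHypergraph.natRk_coe] at h1
  have h2 := M.natRk_le_of_subset_closure (insert_subset hs hXY)
  have h3 : M.natRk (insert s X) = M.natRk X + 1 := by exact_mod_cast h1
  omega

/-- If `X` and `Y` form a modular pair relative to `Z ⊆ X ∩ Y`, then the closures of `X` and `Y`
meet in the closure of `Z`. -/
theorem mem_closure_of_modular [Finite S] {X Y Z : Set S} {s : S} (hX : s ∈ M.closure X)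
    (hY : s ∈ M.closure Y) (hZX : Z ⊆ X) (hZY : Z ⊆ Y) (hZ : Z ⊆ M.E)
    (h : M.natRk X + M.natRk Y ≤ M.natRk Z + M.natRk (X ∪ Y)) : s ∈ M.closure Z := by
  by_contra hsZ
  have h1 : M.natRk Z < M.natRk (M.closure X ∩ M.closure Y) :=
    M.natRk_lt_of_mem_closure (fun z hz => M.mem_closure_of_mem'
        ⟨M.mem_closure_of_mem' (hZX hz) (hZ hz), M.mem_closure_of_mem' (hZY hz) (hZ hz)⟩ (hZ hz))
      (M.mem_closure_of_mem' ⟨hX, hY⟩ (M.closure_subset_ground _ hX)) hsZ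
  have h2 := MixedHypergraph.natRk_submod M (M.closure X) (M.closure Y)
  have h3 : M.natRk (M.closure X ∪ M.closure Y) = M.natRk (X ∪ Y) := by
    rw [← natRk_closure, closure_union_closure_left_eq, closure_union_closure_right_eq,
      natRk_closure]
  rw [natRk_closure, natRk_closure, h3] at h2
  omega

theorem Indep.natRk_eq_ncard {M : Matroid S} {I : Set S} (hI : M.Indep I) :
    M.natRk I = I.ncard := by
  rw [natRk, hI.eRk_eq_encard, ncard_def]

theorem indep_of_ncard_le_natRk [Finite S] {I : Set S} (h : I.ncard ≤ M.natRk I) : M.Indep I := by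
  rw [indep_iff_eRk_eq_encard_of_finite (toFinite I)]
  refine (M.eRk_le_encard I).antisymm ?_
  rw [← MixedHypergraph.natRk_coe, ← (toFinite I).cast_ncard_eq]
  exact_mod_cast h

theorem IsBase.ncard_eq_natRk {M : Matroid S} {B : Set S} (hB : M.IsBase B) :
    B.ncard = M.natRk M.E := by
  rw [natRk, eRk_ground, ← hB.encard_eq_eRank, ncard_def]

theorem Indep.isBase_of_natRk_le [Finite S] {M : Matroid S} {I : Set S} (hI : M.Indep I)
    (h : M.natRk M.E ≤ M.natRk I) : M.IsBase I := by
  refine hI.isBase_of_eRk_ge (toFinite I) ?_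
  rw [← eRk_ground, ← MixedHypergraph.natRk_coe, ← MixedHypergraph.natRk_coe]
  exact_mod_cast h

end Matroid

/-! ### Trimming a covering family of dyperedges -/

section Trimming

variable {U ι : Type*}

/-- The dyperedges of `A`, given by their tails and heads, that enter the set `X`. -/
def enteringIn (A : Set ι) (tail : ι → Set U) (head : ι → U) (X : Set U) : Set ι :=
  {a | a ∈ A ∧ head a ∈ X ∧ (tail a \ X).Nonempty}

theorem ncard_enteringIn_submod [Finite ι] (A : Set ι) (tail : ι → Set U) (head : ι → U)
    (X Y : Set U) :
    (enteringIn A tail head (X ∪ Y)).ncard + (enteringIn A tail head (X ∩ Y)).ncard ≤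
      (enteringIn A tail head X).ncard + (enteringIn A tail head Y).ncard := by
  rw [← ncard_union_add_ncard_inter, ← ncard_union_add_ncard_inter (enteringIn A tail head X)]
  refine Nat.add_le_add (ncard_le_ncard ?_) (ncard_le_ncard ?_)
  · rintro a (⟨h1, h2, u, hu, huX⟩ | ⟨h1, h2, u, hu, huX⟩)
    · rcases h2 with h2 | h2
      · exact Or.inl ⟨h1, h2, u, hu, fun h => huX (Or.inl h)⟩
      · exact Or.inr ⟨h1, h2, u, hu, fun h => huX (Or.inr h)⟩
    · by_cases h : u ∈ X
      · exact Or.inr ⟨h1, h2.2, u, hu, fun h' => huX ⟨h, h'⟩⟩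
      · exact Or.inl ⟨h1, h2.1, u, hu, h⟩
  · rintro a ⟨⟨h1, h2, u, hu, huX⟩, ⟨-, h2', -⟩⟩
    exact ⟨⟨h1, h2'.1, u, hu, fun h => huX (Or.inl h)⟩, ⟨h1, h2'.2, u, hu, fun h => huX (Or.inr h)⟩⟩

/-- The dyperedge a enters X, Y and X ∩ Y but not X ∪ Y, so it contributes two to the right side and
only one to the left. The other dyperedges obey plain submodularity. -/
theorem ncard_enteringIn_submod_lt [Finite ι] {A : Set ι} {tail : ι → Set U} {head : ι → U}
    {X Y : Set U} {a : ι} (hX : a ∈ enteringIn A tail head X) (hY : a ∈ enteringIn A tail head Y)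
    (ha : tail a ⊆ X ∪ Y) :
    (enteringIn A tail head (X ∪ Y)).ncard + (enteringIn A tail head (X ∩ Y)).ncard <
      (enteringIn A tail head X).ncard + (enteringIn A tail head Y).ncard := by
  have key : ∀ Z, a ∈ enteringIn A tail head Z → (enteringIn A tail head Z).ncard =
      (enteringIn (A \ {a}) tail head Z).ncard + 1 := by
    intro Z hZ
    rw [← ncard_sdiff_singleton_add_one hZ]
    congr 2
    ext b
    simp only [enteringIn, mem_sdiff, mem_ofPred_eq, mem_singleton_iff]
    tauto
  have h1 : enteringIn A tail head (X ∪ Y) = enteringIn (A \ {a}) tail head (X ∪ Y) := by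
    ext b
    constructor
    · rintro ⟨h1, h2, h3⟩
      refine ⟨⟨h1, ?_⟩, h2, h3⟩
      rintro rfl
      obtain ⟨u, hu, hu'⟩ := h3
      exact hu' (ha hu)
    · rintro ⟨h1, h2⟩
      exact ⟨h1.1, h2⟩
  have h2 : a ∈ enteringIn A tail head (X ∩ Y) := by
    obtain ⟨u, hu, hu'⟩ := hX.2.2
    exact ⟨hX.1, ⟨hX.2.1, hY.2.1⟩, u, hu, fun h => hu' h.1⟩
  have h3 := ncard_enteringIn_submod (A \ {a}) tail head X Y
  rw [key X hX, key Y hY, key _ h2, h1]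
  omega

/-- If the dyperedges in `A` cover the set function `k - g`, with `g` submodular, then they can be
trimmed to arcs that still cover it. -/
theorem exists_trimming_covering [Finite U] [Finite ι] (A : Set ι) (tail : ι → Set U)
    (head : ι → U) (tail_nonempty : ∀ a, (tail a).Nonempty) (g : Set U → ℕ)
    (submod : ∀ X Y, g (X ∪ Y) + g (X ∩ Y) ≤ g X + g Y) (k : ℕ)
    (h : ∀ X : Set U, X.Nonempty → k ≤ g X + (enteringIn A tail head X).ncard) :
    ∃ src : ι → U, (∀ a, src a ∈ tail a) ∧ ∀ X : Set U, X.Nonempty →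
      k ≤ g X + (enteringIn A (fun a => {src a}) head X).ncard := by
  classical
  let T : Set (ι → Set U) := {t | (∀ a, (t a).Nonempty) ∧ (∀ a, t a ⊆ tail a) ∧
    ∀ X : Set U, X.Nonempty → k ≤ g X + (enteringIn A t head X).ncard}
  -- Take inclusion-minimal tails that still cover. If u cannot be removed from `t a`, some tight
  -- set X entered by a contains all of `t a` except u.
  obtain ⟨t, ht⟩ := (toFinite T).exists_minimal ⟨tail, tail_nonempty, fun _ => Subset.rfl, h⟩
  obtain ⟨t1, t2, t3⟩ := ht.prop
  have key : ∀ a, ∀ u ∈ t a, ∀ w ∈ t a, w ≠ u → ∃ X : Set U,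
      a ∈ enteringIn A t head X ∧ t a \ X ⊆ {u} ∧ g X + (enteringIn A t head X).ncard ≤ k := by
    intro a u hu w hw hwu
    by_contra! hcon
    have hmem : Function.update t a (t a \ {u}) ∈ T := by
      refine ⟨fun b => ?_, fun b => ?_, fun X hX => ?_⟩
      · rcases eq_or_ne b a with rfl | hb
        · rw [Function.update_self]; exact ⟨w, hw, hwu⟩
        · rw [Function.update_of_ne hb]; exact t1 b
      · rcases eq_or_ne b a with rfl | hb
        · rw [Function.update_self]; exact sdiff_subset.trans (t2 b)
        · rw [Function.update_of_ne hb]; exact t2 b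
      · have hsub : enteringIn A t head X \ {a} ⊆
            enteringIn A (Function.update t a (t a \ {u})) head X := by
          rintro b ⟨⟨h1, h2, h3⟩, hb⟩
          refine ⟨h1, h2, ?_⟩
          rwa [Function.update_of_ne hb]
        have hle := ncard_le_ncard hsub
        by_cases haX : a ∈ enteringIn A t head X
        · by_cases htX : t a \ X ⊆ {u}
          · have h1 := hcon X haX htX
            have h2 := ncard_sdiff_singleton_add_one haX
            omega
          · obtain ⟨x, hx, hxu⟩ := not_subset.1 htX
            refine (t3 X hX).trans (Nat.add_le_add_left (ncard_le_ncard ?_) _)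
            intro b hb
            rcases eq_or_ne b a with rfl | hba
            · refine ⟨hb.1, hb.2.1, x, ?_, hx.2⟩
              rw [Function.update_self]
              exact ⟨hx.1, hxu⟩
            · exact hsub ⟨hb, hba⟩
        · rw [sdiff_singleton_eq_self haX] at hle
          exact (t3 X hX).trans (by omega)
    have hle : t ≤ Function.update t a (t a \ {u}) := by
      refine ht.le_of_le hmem fun b => ?_
      rcases eq_or_ne b a with rfl | hb
      · rw [Function.update_self]; exact sdiff_subset
      · rw [Function.update_of_ne hb]
    have := hle a hu
    rw [Function.update_self] at this
    exact this.2 rfl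
  have hsing : ∀ a, ∃ u, t a = {u} := by
    intro a
    obtain ⟨u, hu⟩ := t1 a
    refine ⟨u, subset_antisymm (fun w hw => ?_) (by simpa using hu)⟩
    by_contra hwu
    -- Two vertices in the same tail give two tight sets that together contain the tail. Strict
    -- submodularity then makes the union or the intersection violate the covering condition.
    obtain ⟨X, hX, hX1, hX2⟩ := key a u hu w hw hwu
    obtain ⟨Y, hY, hY1, hY2⟩ := key a w hw u hu (Ne.symm hwu)
    have hXY : t a ⊆ X ∪ Y := by
      intro x hx
      by_contra hxn
      have h1 : x = u := hX1 ⟨hx, fun h => hxn (Or.inl h)⟩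
      have h2 : x = w := hY1 ⟨hx, fun h => hxn (Or.inr h)⟩
      exact hwu (h2.symm.trans h1)
    have h1 := ncard_enteringIn_submod_lt hX hY hXY
    have h2 := submod X Y
    have h3 := t3 (X ∪ Y) ⟨_, Or.inl hX.2.1⟩
    have h4 := t3 (X ∩ Y) ⟨_, hX.2.1, hY.2.1⟩
    omega
  choose src hsrc using hsing
  refine ⟨src, fun a => t2 a (by simp [hsrc a]), ?_⟩
  rw [← funext hsrc]
  exact t3

end Trimming

/-! ### Matroid-based packings by greedy growth -/

section Growth

variable {U ι S : Type*}

/-- The arcs of `A` with sources `src` and targets `tgt` that enter `X`. -/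
def arcsInto (A : Set ι) (src tgt : ι → U) (X : Set U) : Set ι :=
  enteringIn A (fun a => {src a}) tgt X

theorem mem_arcsInto {A : Set ι} {src tgt : ι → U} {X : Set U} {a : ι} :
    a ∈ arcsInto A src tgt X ↔ a ∈ A ∧ tgt a ∈ X ∧ src a ∉ X := by
  simp only [arcsInto, enteringIn, mem_ofPred_eq]
  refine and_congr_right fun _ => and_congr_right fun _ => ?_
  simp [Set.Nonempty]

theorem natRk_biUnion_submod [Finite S] (M : Matroid S) (P : U → Set S) (X Y : Set U) :
    M.natRk (⋃ u ∈ X ∪ Y, P u) + M.natRk (⋃ u ∈ X ∩ Y, P u) ≤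
      M.natRk (⋃ u ∈ X, P u) + M.natRk (⋃ u ∈ Y, P u) := by
  rw [biUnion_union]
  have h1 := MixedHypergraph.natRk_submod M (⋃ u ∈ X, P u) (⋃ u ∈ Y, P u)
  have h2 : M.natRk (⋃ u ∈ X ∩ Y, P u) ≤ M.natRk ((⋃ u ∈ X, P u) ∩ ⋃ u ∈ Y, P u) :=
    MixedHypergraph.natRk_mono M (subset_inter (biUnion_subset_biUnion_left inter_subset_left)
      (biUnion_subset_biUnion_left inter_subset_right))
  omega

theorem subset_closure_of_reflTransGen (M : Matroid S) {P : U → Set S} (hP : ∀ u, M.Indep (P u))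
    {step : U → U → Prop} (hstep : ∀ x y, step x y → P x ⊆ M.closure (P y)) {x y : U}
    (h : Relation.ReflTransGen step x y) : P x ⊆ M.closure (P y) := by
  induction h using Relation.ReflTransGen.head_induction_on with
  | refl => exact M.subset_closure _ (hP y).subset_ground
  | head hab _ ih => exact (hstep _ _ hab).trans (M.closure_subset_closure_of_subset_closure ih)

/-- The resulting arc can be spent on carrying s to its target. Deleting it can only hurt a tight
set that it enters and whose rank does not grow with s, and no such set exists. If every candidate
were blocked by such a set, a minimal blocking set would lead to a contradiction. -/
theorem exists_extendable_arc [Finite U] [Finite ι] [Finite S] (M : Matroid S) (src tgt : ι → U)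
    (A : Set ι) (P : U → Set S) (hP : ∀ u, M.Indep (P u)) (k : ℕ)
    (h : ∀ X : Set U, X.Nonempty → k ≤ M.natRk (⋃ u ∈ X, P u) + (arcsInto A src tgt X).ncard)
    (hgood : ∃ a ∈ A, ¬ P (src a) ⊆ M.closure (P (tgt a))) :
    ∃ a ∈ A, ∃ s ∈ P (src a), s ∉ M.closure (P (tgt a)) ∧
      ∀ X : Set U, tgt a ∈ X → src a ∉ X → s ∈ M.closure (⋃ u ∈ X, P u) →
        k < M.natRk (⋃ u ∈ X, P u) + (arcsInto A src tgt X).ncard := by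
  by_contra! hcon
  let T : Set (Set U) := {X | ∃ a ∈ A, ∃ s ∈ P (src a), s ∉ M.closure (P (tgt a)) ∧
    tgt a ∈ X ∧ src a ∉ X ∧ s ∈ M.closure (⋃ u ∈ X, P u) ∧
    M.natRk (⋃ u ∈ X, P u) + (arcsInto A src tgt X).ncard ≤ k}
  have hT : T.Nonempty := by
    obtain ⟨a, ha, hna⟩ := hgood
    obtain ⟨s, hs, hsn⟩ := not_subset.1 hna
    obtain ⟨X, hX⟩ := hcon a ha s hs hsn
    exact ⟨X, a, ha, s, hs, hsn, hX⟩
  obtain ⟨X, hX⟩ := (toFinite T).exists_minimal hT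
  obtain ⟨a, ha, s, hs, hsn, haX, haX', hsX, htight⟩ := hX.prop
  have hground : ∀ Z : Set U, (⋃ u ∈ Z, P u) ⊆ M.E :=
    fun Z => iUnion₂_subset fun u _ => (hP u).subset_ground
  by_cases hbad : ∀ b ∈ A, src b ∈ X → tgt b ∈ X → P (src b) ⊆ M.closure (P (tgt b))
  · let step : U → U → Prop := fun x y => ∃ b ∈ A, src b = x ∧ tgt b = y ∧ x ∈ X ∧ y ∈ X
    -- Z consists of the vertices that reach `tgt a` inside X. If no arc inside X carries anything
    -- new, `P (tgt a)` spans all of P on Z, so Z has smaller rank than X. Every arc entering Z also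
    -- enters X, so Z violates the cut condition.
    let Z : Set U := {x | Relation.ReflTransGen step x (tgt a)}
    have hZX : Z ⊆ X := by
      intro x hx
      rcases Relation.ReflTransGen.cases_head hx with rfl | ⟨y, ⟨b, hb⟩, -⟩
      · exact haX
      · exact hb.2.2.2.1
    have h1 : M.natRk (⋃ u ∈ Z, P u) ≤ M.natRk (P (tgt a)) := by
      refine M.natRk_le_of_subset_closure (iUnion₂_subset fun u hu => ?_)
      refine subset_closure_of_reflTransGen M hP ?_ hu
      rintro x y ⟨b, hb, rfl, rfl, hx, hy⟩
      exact hbad b hb hx hy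
    have h2 : M.natRk (P (tgt a)) < M.natRk (⋃ u ∈ X, P u) :=
      M.natRk_lt_of_mem_closure ((subset_biUnion_of_mem haX).trans
        (M.subset_closure _ (hground X))) hsX hsn
    have h3 : (arcsInto A src tgt Z).ncard ≤ (arcsInto A src tgt X).ncard := by
      refine ncard_le_ncard fun b hb => ?_
      rw [mem_arcsInto] at hb ⊢
      refine ⟨hb.1, hZX hb.2.1, fun hbX => hb.2.2 ?_⟩
      exact Relation.ReflTransGen.head ⟨b, hb.1, rfl, rfl, hbX, hZX hb.2.1⟩ hb.2.1
    have h4 := h Z ⟨tgt a, Relation.ReflTransGen.refl⟩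
    omega
  · push Not at hbad
    obtain ⟨b, hb, hbs, hbt, hbn⟩ := hbad
    obtain ⟨t, ht, htn⟩ := not_subset.1 hbn
    -- Uncrossing the tight sets X and Y forces equality in the submodularity of the rank, so t is
    -- spanned on X ∩ Y. Then X ∩ Y blocks (b, t), and it is smaller than X because `src b` lies in
    -- X but not in Y.
    obtain ⟨Y, hY1, hY2, hY3, hY4⟩ := hcon b hb t ht htn
    have h1 := h (X ∪ Y) ⟨_, Or.inl hbt⟩
    have h2 := h (X ∩ Y) ⟨_, hbt, hY1⟩
    have h3 := natRk_biUnion_submod M P X Y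
    have h4 : (arcsInto A src tgt (X ∪ Y)).ncard + (arcsInto A src tgt (X ∩ Y)).ncard ≤
        (arcsInto A src tgt X).ncard + (arcsInto A src tgt Y).ncard :=
      ncard_enteringIn_submod A _ tgt X Y
    have htX : t ∈ M.closure (⋃ u ∈ X, P u) :=
      M.mem_closure_of_mem' (mem_biUnion hbs ht) ((hP _).subset_ground ht)
    have htXY : t ∈ M.closure (⋃ u ∈ X ∩ Y, P u) := by
      refine M.mem_closure_of_modular htX hY3 (biUnion_subset_biUnion_left inter_subset_left)
        (biUnion_subset_biUnion_left inter_subset_right) (hground _) ?_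
      rw [← biUnion_union]
      omega
    have hXY : X ∩ Y ∈ T :=
      ⟨b, hb, t, ht, htn, ⟨hbt, hY1⟩, fun hh => hY2 hh.2, htXY, by omega⟩
    exact hY2 (hX.le_of_le hXY inter_subset_left hbs).2

/-- A matroid-based packing of arborescences exists under the cut condition. The independent sets
`P u` of roots placed at the vertices `u` grow along the arcs of `F s` to bases `Q u`. -/
theorem exists_growth_to_bases [Finite U] [Finite ι] [Finite S] (M : Matroid S)
    (src tgt : ι → U) (A : Set ι) (P : U → Set S) (hP : ∀ u, M.Indep (P u))
    (h : ∀ X : Set U, X.Nonempty →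
      M.natRk M.E ≤ M.natRk (⋃ u ∈ X, P u) + (arcsInto A src tgt X).ncard) :
    ∃ (Q : U → Set S) (F : S → Set ι), (∀ u, P u ⊆ Q u) ∧ (∀ u, M.IsBase (Q u)) ∧
      (∀ s, F s ⊆ A) ∧ Pairwise (Function.onFun Disjoint F) ∧
      (∀ s, ∀ a ∈ F s, s ∈ Q (src a) ∧ s ∈ Q (tgt a) ∧ s ∉ P (tgt a)) ∧
      (∀ s u, s ∈ Q u → s ∉ P u → ∃! a, a ∈ F s ∧ tgt a = u) ∧
      ∀ s, ∀ T : Set U, (∀ u, s ∈ P u → u ∈ T) → (∀ a ∈ F s, src a ∈ T → tgt a ∈ T) →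
        ∀ u, s ∈ Q u → u ∈ T := by
  classical
  induction hn : A.ncard using Nat.strong_induction_on generalizing A P with
  | _ n ih =>
  by_cases hgood : ∃ a ∈ A, ¬ P (src a) ⊆ M.closure (P (tgt a))
  · obtain ⟨a, ha, s, hs, hsn, hfree⟩ := exists_extendable_arc M src tgt A P hP _ h hgood
    have hsv : s ∉ P (tgt a) := fun hh =>
      hsn (M.mem_closure_of_mem' hh ((hP _).subset_ground hh))
    let P' : U → Set S := Function.update P (tgt a) (insert s (P (tgt a)))
    have hP'v : P' (tgt a) = insert s (P (tgt a)) := Function.update_self ..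
    have hP'ne : ∀ u, u ≠ tgt a → P' u = P u := fun u hu => Function.update_of_ne hu ..
    have hPP' : ∀ u, P u ⊆ P' u := by
      intro u
      rcases eq_or_ne u (tgt a) with rfl | hu
      · rw [hP'v]; exact subset_insert _ _
      · rw [hP'ne u hu]
    have hP'mem : ∀ u t, t ∈ P' u → t ∈ P u ∨ (t = s ∧ u = tgt a) := by
      intro u t ht
      rcases eq_or_ne u (tgt a) with rfl | hu
      · rw [hP'v] at ht
        exact ht.symm.imp id fun h => ⟨h, rfl⟩
      · rw [hP'ne u hu] at ht
        exact Or.inl ht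
    have hP' : ∀ u, M.Indep (P' u) := by
      intro u
      rcases eq_or_ne u (tgt a) with rfl | hu
      · rw [hP'v]
        exact ((hP _).notMem_closure_iff ((hP _).subset_ground hs)).1 hsn |>.1
      · rw [hP'ne u hu]; exact hP u
    have hcut : ∀ X : Set U, X.Nonempty → M.natRk M.E ≤
        M.natRk (⋃ u ∈ X, P' u) + (arcsInto (A \ {a}) src tgt X).ncard := by
      intro X hX
      have h1 : M.natRk (⋃ u ∈ X, P u) ≤ M.natRk (⋃ u ∈ X, P' u) :=
        MixedHypergraph.natRk_mono M (biUnion_mono Subset.rfl fun u _ => hPP' u)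
      have h2 := h X hX
      have hdel : arcsInto (A \ {a}) src tgt X = arcsInto A src tgt X \ {a} := by
        ext b
        simp only [mem_sdiff, mem_arcsInto, mem_singleton_iff]
        tauto
      -- Only a set entered by a loses an arc. Either s is already spanned there and `hfree`
      -- provides slack, or the added s raises the rank by one.
      by_cases haX : a ∈ arcsInto A src tgt X
      · have h3 := ncard_sdiff_singleton_add_one haX
        rw [← hdel] at h3
        rw [mem_arcsInto] at haX
        by_cases hsX : s ∈ M.closure (⋃ u ∈ X, P u)
        · have := hfree X haX.2.1 haX.2.2 hsX
          omega
        · have h4 : M.natRk (⋃ u ∈ X, P u) < M.natRk (⋃ u ∈ X, P' u) := by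
            have hE : (⋃ u ∈ X, P' u) ⊆ M.E := iUnion₂_subset fun u _ => (hP' u).subset_ground
            refine M.natRk_lt_of_mem_closure ?_ ?_ hsX
            · exact (biUnion_mono Subset.rfl fun u _ => hPP' u).trans (M.subset_closure _ hE)
            · refine M.subset_closure _ hE (mem_biUnion haX.2.1 ?_)
              rw [hP'v]
              exact mem_insert _ _
          omega
      · rw [hdel, sdiff_singleton_eq_self haX]
        omega
    have hcard : (A \ {a}).ncard < n := by
      rw [← hn]
      exact ncard_sdiff_singleton_lt_of_mem ha
    obtain ⟨Q, F, hPQ, hQ, hFA, hdisj, hF, huniq, hreach⟩ := ih _ hcard _ P' hP' hcut rfl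
    have haF : ∀ t, a ∉ F t := fun t hat => (hFA t hat).2 rfl
    have hsQ : s ∈ Q (tgt a) := hPQ _ (by rw [hP'v]; exact mem_insert _ _)
    let F' : S → Set ι := Function.update F s (insert a (F s))
    have hF's : F' s = insert a (F s) := Function.update_self ..
    have hF'ne : ∀ t, t ≠ s → F' t = F t := fun t ht => Function.update_of_ne ht ..
    have hFF' : ∀ t, F t ⊆ F' t := by
      intro t
      rcases eq_or_ne t s with rfl | ht
      · rw [hF's]; exact subset_insert _ _
      · rw [hF'ne t ht]
    have hF'mem : ∀ t b, b ∈ F' t → b ∈ F t ∨ (t = s ∧ b = a) := by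
      intro t b hb
      rcases eq_or_ne t s with rfl | ht
      · rw [hF's] at hb
        exact hb.symm.imp id fun h => ⟨rfl, h⟩
      · rw [hF'ne t ht] at hb
        exact Or.inl hb
    refine ⟨Q, F', fun u => (hPP' u).trans (hPQ u), hQ, ?_, ?_, ?_, ?_, ?_⟩
    · intro t b hb
      rcases hF'mem t b hb with hb | ⟨-, rfl⟩
      · exact (hFA t hb).1
      · exact ha
    · intro t t' htt'
      refine Set.disjoint_left.2 fun b hb hb' => ?_
      rcases hF'mem t b hb with hb | ⟨rfl, rfl⟩ <;> rcases hF'mem t' b hb' with hb' | ⟨h1, h2⟩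
      · exact Set.disjoint_left.1 (hdisj htt') hb hb'
      · exact haF t (h2 ▸ hb)
      · exact haF t' hb'
      · exact htt' h1.symm
    · intro t b hb
      rcases hF'mem t b hb with hb | ⟨rfl, rfl⟩
      · exact ⟨(hF t b hb).1, (hF t b hb).2.1, fun hh => (hF t b hb).2.2 (hPP' _ hh)⟩
      · exact ⟨hPQ _ (hPP' _ hs), hsQ, hsv⟩
    · intro t u htQ htP
      -- At the new pair, a is the only entering arc: the arcs supplied by induction never carry s
      -- to a vertex where `P'` already has it.
      by_cases hcase : t = s ∧ u = tgt a
      · obtain ⟨rfl, rfl⟩ := hcase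
        refine ⟨a, ⟨by rw [hF's]; exact mem_insert _ _, rfl⟩, ?_⟩
        rintro b ⟨hb, hbt⟩
        rcases hF'mem t b hb with hb | ⟨-, rfl⟩
        · refine absurd ?_ (hF t b hb).2.2
          rw [hbt, hP'v]
          exact mem_insert _ _
        · rfl
      · have htP' : t ∉ P' u := fun hh => (hP'mem u t hh).elim htP hcase
        obtain ⟨b, ⟨hb, hbu⟩, hb'⟩ := huniq t u htQ htP'
        refine ⟨b, ⟨hFF' t hb, hbu⟩, ?_⟩
        rintro c ⟨hc, hcu⟩
        rcases hF'mem t c hc with hc | ⟨rfl, rfl⟩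
        · exact hb' c ⟨hc, hcu⟩
        · exact absurd ⟨rfl, hcu.symm⟩ hcase
    · intro t T hT hclosed
      refine hreach t T (fun u hu => ?_) fun b hb => hclosed b (hFF' t hb)
      rcases hP'mem u t hu with hu | ⟨rfl, rfl⟩
      · exact hT u hu
      · exact hclosed a (by rw [hF's]; exact mem_insert _ _) (hT _ hs)
  · push Not at hgood
    refine ⟨P, fun _ => ∅, fun _ => Subset.rfl, fun u => ?_, fun _ => empty_subset _,
      fun _ _ _ => disjoint_empty _, fun _ _ ha => absurd ha (notMem_empty _),
      fun s u h1 h2 => absurd h1 h2, fun s T hT _ => hT⟩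
    let step : U → U → Prop := fun x y => ∃ b ∈ A, src b = x ∧ tgt b = y
    -- No arc enters the set of vertices that reach u, and its rank is at most that of `P u`. The
    -- cut condition therefore makes `P u` a base.
    let X : Set U := {x | Relation.ReflTransGen step x u}
    have h1 : M.natRk (⋃ x ∈ X, P x) ≤ M.natRk (P u) := by
      refine M.natRk_le_of_subset_closure (iUnion₂_subset fun x hx => ?_)
      refine subset_closure_of_reflTransGen M hP ?_ hx
      rintro x y ⟨b, hb, rfl, rfl⟩
      exact hgood b hb
    have h2 : arcsInto A src tgt X = ∅ := by
      refine eq_empty_of_forall_notMem fun b hb => ?_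
      rw [mem_arcsInto] at hb
      exact hb.2.2 (Relation.ReflTransGen.head ⟨b, hb.1, rfl, rfl⟩ hb.2.1)
    have h3 := h X ⟨u, Relation.ReflTransGen.refl⟩
    rw [h2, ncard_empty] at h3
    exact (hP u).isBase_of_natRk_le (by omega)

end Growth

/-! ### Arborescences and reachability -/

namespace ArcDigraph

variable {W ι : Type*} {B : ArcDigraph W ι} {r : W}

/-- A set containing the root and closed under following arcs contains all vertices. -/
theorem IsArborescence.verts_subset_of_closed (hB : B.IsArborescence r) {T : Set W} (hr : r ∈ T)
    (hT : ∀ a ∈ B.arcs, B.src a ∈ T ↔ B.tgt a ∈ T) : B.verts ⊆ T := by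
  intro v hv
  have hconn := hB.isTree.connected.preconnected ⟨r, hB.root_mem⟩ ⟨v, hv⟩
  rw [SimpleGraph.reachable_iff_reflTransGen] at hconn
  have : ∀ w : B.verts, Relation.ReflTransGen B.underlying.Adj ⟨r, hB.root_mem⟩ w → w.1 ∈ T := by
    intro w hw
    induction hw with
    | refl => exact hr
    | tail _ hbc ih =>
      rw [underlying, SimpleGraph.fromRel_adj] at hbc
      obtain ⟨-, ⟨a, ha, h1, h2⟩ | ⟨a, ha, h1, h2⟩⟩ := hbc
      · rw [← h2, ← hT a ha, h1]; exact ih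
      · rw [← h1, hT a ha, h2]; exact ih
  exact this _ hconn

/-- A nonempty set of vertices that is closed under taking predecessors contains the root. -/
theorem IsArborescence.root_mem_of_closed (hB : B.IsArborescence r) {X : Set W} {v : W}
    (hvX : v ∈ X) (hv : v ∈ B.verts) (hX : ∀ a ∈ B.arcs, B.tgt a ∈ X → B.src a ∈ X) : r ∈ X := by
  let step : W → W → Prop := fun x y => ∃ a ∈ B.arcs, B.src a = x ∧ B.tgt a = y
  have hreach : B.verts ⊆ {w | Relation.ReflTransGen step r w} := by
    refine hB.verts_subset_of_closed Relation.ReflTransGen.refl fun a ha =>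
      ⟨fun h => ?_, fun h => ?_⟩
    · exact Relation.ReflTransGen.tail h ⟨a, ha, rfl, rfl⟩
    · rcases Relation.ReflTransGen.cases_tail h with h | ⟨x, hx, b, hb, rfl, hba⟩
      · exact absurd h (hB.root_not_entered a ha)
      · have := (hB.existsUnique_arc _ (B.tgt_mem a ha) (hB.root_not_entered a ha)).unique
          ⟨hb, hba⟩ ⟨ha, rfl⟩
        rwa [← this]
  have hrv : Relation.ReflTransGen step r v := hreach hv
  clear hreach hB
  induction hrv using Relation.ReflTransGen.head_induction_on with
  | refl => exact hvX
  | head hab _ ih =>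
    obtain ⟨a, ha, rfl, rfl⟩ := hab
    exact hX a ha ih

/-- Reachability from r gives connectedness. Sending an arc to its target is injective into the
vertices other than r, so there are at most |verts| - 1 edges, and a connected graph with so few
edges is a tree. -/
theorem isArborescence_of_reachable [Finite W] [Finite ι] (root_mem : r ∈ B.verts)
    (root_not_entered : ∀ a ∈ B.arcs, B.tgt a ≠ r)
    (existsUnique_arc : ∀ v ∈ B.verts, v ≠ r → ∃! a, a ∈ B.arcs ∧ B.tgt a = v)
    (reach : ∀ T : Set W, r ∈ T → (∀ a ∈ B.arcs, B.src a ∈ T → B.tgt a ∈ T) → B.verts ⊆ T) :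
    B.IsArborescence r := by
  have hreach : ∀ v : B.verts, B.underlying.Reachable ⟨r, root_mem⟩ v := by
    have := reach {v | ∃ h : v ∈ B.verts, B.underlying.Reachable ⟨r, root_mem⟩ ⟨v, h⟩}
      ⟨root_mem, SimpleGraph.Reachable.refl _⟩ (by
        rintro a ha ⟨h, hr⟩
        refine ⟨B.tgt_mem a ha, ?_⟩
        by_cases hloop : B.src a = B.tgt a
        · simpa only [hloop] using hr
        · refine hr.trans (SimpleGraph.Adj.reachable ?_)
          rw [underlying, SimpleGraph.fromRel_adj]
          exact ⟨fun h => hloop (congrArg Subtype.val h), Or.inl ⟨a, ha, rfl, rfl⟩⟩)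
    intro v
    exact (this v.2).2
  have hconn : B.underlying.Connected :=
    { preconnected := fun u v => (hreach u).symm.trans (hreach v)
      nonempty := ⟨⟨r, root_mem⟩⟩ }
  refine ⟨root_mem, ?_, root_not_entered, existsUnique_arc⟩
  rw [SimpleGraph.isTree_iff_connected_and_card]
  refine ⟨hconn, le_antisymm ?_ hconn.card_vert_le_card_edgeSet_add_one⟩
  have h1 : B.arcs.ncard ≤ (B.verts \ {r}).ncard := by
    refine ncard_le_ncard_of_injOn B.tgt
      (fun a ha => ⟨B.tgt_mem a ha, root_not_entered a ha⟩) ?_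
    intro a ha b hb hab
    exact (existsUnique_arc _ (B.tgt_mem a ha) (root_not_entered a ha)).unique ⟨ha, rfl⟩
      ⟨hb, hab.symm⟩
  have h2 := ncard_sdiff_singleton_add_one root_mem (toFinite B.verts)
  have h3 : (Subtype.val '' (univ : Set B.verts)).ncard = Nat.card B.verts := by
    rw [ncard_image_of_injective _ Subtype.val_injective, ncard_univ]
  have h4 : B.underlying.edgeSet.ncard ≤ B.arcs.ncard := by
    let g : B.arcs → Sym2 B.verts :=
      fun a => s(⟨B.src a, B.src_mem a a.2⟩, ⟨B.tgt a, B.tgt_mem a a.2⟩)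
    have hsub : B.underlying.edgeSet ⊆ g '' univ := by
      intro e
      induction e using Sym2.ind with
      | _ u v =>
        intro he
        rw [SimpleGraph.mem_edgeSet, underlying, SimpleGraph.fromRel_adj] at he
        obtain ⟨-, ⟨a, ha, h1, h2⟩ | ⟨a, ha, h1, h2⟩⟩ := he
        · exact ⟨⟨a, ha⟩, trivial, by simp [g, h1, h2]⟩
        · exact ⟨⟨a, ha⟩, trivial, by simp [g, h1, h2, Sym2.eq_swap]⟩
    refine (ncard_le_ncard hsub).trans ((ncard_image_le).trans ?_)
    rw [ncard_univ, Nat.card_coe_set_eq]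
  rw [Subtype.coe_image_univ] at h3
  rw [Nat.card_coe_set_eq]
  omega

end ArcDigraph

/-! ### Counting along fibres -/

theorem Set.ncard_eq_sum_ncard_fiber {α β : Type*} [Finite α] (A : Set α) (f : α → β)
    (V : Finset β) (h : ∀ a ∈ A, f a ∈ V) : A.ncard = ∑ v ∈ V, {a | a ∈ A ∧ f a = v}.ncard := by
  classical
  have := Fintype.ofFinite α
  rw [ncard_eq_toFinset_card', Finset.card_eq_sum_card_fiberwise (f := f) (t := V)
    (fun a ha => h a (by simpa using ha))]
  refine Finset.sum_congr rfl fun v _ => ?_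
  rw [ncard_eq_toFinset_card']
  congr 1
  ext a
  simp

theorem Set.ncard_sigma_of_forall_ncard_eq {α β : Type*} [Finite α] [Finite β] (X : Set α)
    (C : α → Set β) (k : ℕ) (h : ∀ x ∈ X, (C x).ncard = k) :
    {p : α × β | p.1 ∈ X ∧ p.2 ∈ C p.1}.ncard = k * X.ncard := by
  classical
  have := Fintype.ofFinite α
  rw [ncard_eq_sum_ncard_fiber _ Prod.fst X.toFinset (fun p hp => by simpa using hp.1),
    Finset.sum_congr rfl (g := fun _ => k), Finset.sum_const, ncard_eq_toFinset_card' X, smul_eq_mul,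
    mul_comm]
  intro x hx
  rw [← h x (by simpa using hx), ← ncard_image_of_injective (C x) (Prod.mk_right_injective x)]
  congr 1
  ext ⟨y, c⟩
  simp only [mem_ofPred_eq, mem_image, Prod.mk.injEq]
  constructor
  · rintro ⟨⟨-, h2⟩, rfl⟩
    exact ⟨c, h2, rfl, rfl⟩
  · rintro ⟨c', h1, rfl, rfl⟩
    exact ⟨⟨by simpa using hx, h1⟩, rfl⟩

/-! ### Dyperedge sets of packings -/

namespace Dypergraph

variable {W ι : Type*} (D : Dypergraph W ι)

/-- All vertices in `R` are simple roots of the dypergraph `D`. -/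
structure HasSimpleRoots (R : Set W) : Prop where
  head_notMem : ∀ a, D.head a ∉ R
  tail_eq : ∀ a, ∀ r ∈ R, r ∈ D.tail a → D.tail a = {r}
  leaving_unique : ∀ r ∈ R, ∀ a b, r ∈ D.tail a → r ∈ D.tail b → a = b

/-- The vertices outside `R` that are incident to a dyperedge in `Z`. -/
def incidentVerts (R : Set W) (Z : Set ι) : Set W :=
  {v | v ∉ R ∧ ∃ a ∈ Z, v ∈ insert (D.head a) (D.tail a)}

/-- The vertices in `R` that are in the tail of a dyperedge in `Z`. -/
def tailRoots (R : Set W) (Z : Set ι) : Set W := {r | r ∈ R ∧ ∃ a ∈ Z, r ∈ D.tail a}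

variable {D} {M : Matroid W} {F : M.E → Set ι}

/-- In a matroid-based packing the dyperedges correspond to the pairs of a vertex and a root of an
arborescence containing it. -/
theorem IsMatroidBasedPacking.exists_bijOn (hF : D.IsMatroidBasedPacking M F)
    (hD : D.HasSimpleRoots M.E) :
    ∃ (C : W → Set W) (root : ι → W), (∀ v ∉ M.E, M.IsBase (C v)) ∧
      BijOn (fun a => (D.head a, root a)) (⋃ r, F r) {p | p.1 ∉ M.E ∧ p.2 ∈ C p.1} ∧
      ∀ v ∉ M.E, ∀ r ∈ C v, ∀ X : Set W, v ∈ X →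
        (∀ x ∈ X, x ∉ M.E → r ∈ C x → ∃ a ∈ ⋃ r, F r, D.head a = x ∧ root a = r ∧
          (D.tail a \ M.E ⊆ X) ∧ r ∉ D.tail a) → False := by
  obtain ⟨hdisj, B, hB, hbase⟩ := hF
  let C : W → Set W := fun v => {r | ∃ h : r ∈ M.E, v ∈ (B ⟨r, h⟩).verts}
  have hroot : ∀ a, ∃ r : W, a ∈ ⋃ r, F r → ∃ h : r ∈ M.E, a ∈ F ⟨r, h⟩ := by
    intro a
    by_cases ha : a ∈ ⋃ r, F r
    · obtain ⟨⟨r, h⟩, hr⟩ := mem_iUnion.1 ha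
      exact ⟨r, fun _ => ⟨h, hr⟩⟩
    · exact ⟨D.head a, fun h => absurd h ha⟩
  choose root hroot using hroot
  have root_eq : ∀ r (h : r ∈ M.E), ∀ a ∈ F ⟨r, h⟩, root a = r := by
    intro r h a ha
    obtain ⟨h', ha'⟩ := hroot a (mem_iUnion.2 ⟨_, ha⟩)
    by_contra hne
    exact Set.disjoint_left.1 (hdisj fun he => hne (congrArg Subtype.val he)) ha' ha
  have arcs_eq : ∀ r, (B r).arcs = F r := fun r => (hB r).1.1
  have tgt_eq : ∀ r, ∀ a ∈ F r, (B r).tgt a = D.head a := fun r a ha => ((hB r).1.2 a ha).2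
  have hex : ∀ v ∉ M.E, ∀ r (h : r ∈ M.E), v ∈ (B ⟨r, h⟩).verts →
      ∃! a, a ∈ (B ⟨r, h⟩).arcs ∧ (B ⟨r, h⟩).tgt a = v := fun v hv r h hvr =>
    (hB ⟨r, h⟩).2.existsUnique_arc v hvr fun he => hv (he ▸ h)
  refine ⟨C, root, hbase, ⟨?_, ?_, ?_⟩, ?_⟩
  · intro a ha
    obtain ⟨h, haF⟩ := hroot a ha
    refine ⟨hD.head_notMem a, h, ?_⟩
    change D.head a ∈ _
    rw [← tgt_eq _ a haF]
    exact (B _).tgt_mem a ((arcs_eq _).symm ▸ haF)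
  · intro a ha b hb hab
    obtain ⟨h1, h2⟩ := Prod.mk.inj hab
    obtain ⟨h, haF⟩ := hroot a ha
    obtain ⟨h', hbF⟩ := hroot b hb
    have hbF' : b ∈ F ⟨root a, h⟩ := by
      have : (⟨root a, h⟩ : M.E) = ⟨root b, h'⟩ := Subtype.ext h2
      rwa [this]
    have haB : a ∈ (B ⟨root a, h⟩).arcs := (arcs_eq _).symm ▸ haF
    have hbB : b ∈ (B ⟨root a, h⟩).arcs := (arcs_eq _).symm ▸ hbF'
    refine (hex (D.head a) (hD.head_notMem a) _ h ?_).unique ⟨haB, tgt_eq _ _ haF⟩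
      ⟨hbB, (tgt_eq _ _ hbF').trans h1.symm⟩
    rw [← tgt_eq _ a haF]
    exact (B _).tgt_mem a haB
  · rintro ⟨v, r⟩ ⟨hv, h, hvr⟩
    obtain ⟨a, ⟨ha, hav⟩, -⟩ := hex v hv r h hvr
    rw [arcs_eq] at ha
    refine ⟨a, mem_iUnion.2 ⟨_, ha⟩, Prod.ext ?_ (root_eq r h a ha)⟩
    exact (tgt_eq _ a ha).symm.trans hav
  · rintro v hv r ⟨h, hvr⟩ X hvX hX
    -- The nonroot part of X is closed under predecessors in the arborescence of r, so it would have
    -- to contain r.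
    have := (hB ⟨r, h⟩).2.root_mem_of_closed (X := X \ M.E) ⟨hvX, hv⟩ hvr ?_
    · exact this.2 h
    · rintro a ha ⟨haX, haE⟩
      obtain ⟨b, hb, hbx, hbr, hbX, hrb⟩ := hX _ haX haE ⟨h, (B _).tgt_mem a ha⟩
      obtain ⟨h', hbF⟩ := hroot b hb
      have hbF' : b ∈ F ⟨r, h⟩ := by
        have : (⟨r, h⟩ : M.E) = ⟨root b, h'⟩ := Subtype.ext hbr.symm
        rwa [this]
      have hbB : b ∈ (B ⟨r, h⟩).arcs := (arcs_eq _).symm ▸ hbF'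
      have hab : a = b := (hex _ haE _ h ((B _).tgt_mem a ha)).unique ⟨ha, rfl⟩
        ⟨hbB, (tgt_eq _ _ hbF').trans hbx⟩
      subst hab
      have hsrc := ((hB ⟨r, h⟩).1.2 a hbF').1
      -- Roots are never entered, so a source in `M.E` could only be r, which is not in the tail of
      -- a.
      have hsE : (B ⟨r, h⟩).src a ∉ M.E := by
        intro hsE
        have hne : (B ⟨r, h⟩).src a ≠ r := fun he => hrb (he ▸ hsrc)
        obtain ⟨c, ⟨hc, hcs⟩, -⟩ := (hB ⟨r, h⟩).2.existsUnique_arc _ ((B _).src_mem a ha) hne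
        refine hD.head_notMem c ?_
        rw [← tgt_eq ⟨r, h⟩ c ((arcs_eq _) ▸ hc), hcs]
        exact hsE
      exact ⟨hbX ⟨hsrc, hsE⟩, hsE⟩

theorem IsMatroidBasedPacking.ncard_head_mem [Finite W] [Finite ι]
    (hF : D.IsMatroidBasedPacking M F) (hD : D.HasSimpleRoots M.E) {X : Set W} (hX : X ⊆ M.Eᶜ) :
    {a | a ∈ (⋃ r, F r) ∧ D.head a ∈ X}.ncard = M.natRk M.E * X.ncard := by
  obtain ⟨C, root, hC, hbij, -⟩ := hF.exists_bijOn hD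
  rw [← ncard_sigma_of_forall_ncard_eq X C _ fun x hx => (hC x (hX hx)).ncard_eq_natRk,
    ← (hbij.injOn.mono fun a ha => ha.1).ncard_image]
  congr 1
  ext ⟨v, r⟩
  constructor
  · rintro ⟨a, ⟨ha, haX⟩, hav⟩
    obtain ⟨rfl, rfl⟩ := Prod.mk.inj hav
    exact ⟨haX, (hbij.mapsTo ha).2⟩
  · rintro ⟨hv, hr⟩
    obtain ⟨a, ha, hav⟩ := hbij.surjOn ⟨hX hv, hr⟩
    refine ⟨a, ⟨ha, ?_⟩, hav⟩
    obtain ⟨rfl, -⟩ := Prod.mk.inj hav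
    exact hv

theorem IsMatroidBasedPacking.ncard_add_natRk_le [Finite W] [Finite ι]
    (hF : D.IsMatroidBasedPacking M F) (hD : D.HasSimpleRoots M.E) {Z : Set ι}
    (hZ : Z ⊆ ⋃ r, F r) (hne : Z.Nonempty) :
    Z.ncard + M.natRk M.E ≤
      M.natRk M.E * (D.incidentVerts M.E Z).ncard + M.natRk (D.tailRoots M.E Z) := by
  classical
  obtain ⟨C, root, hC, hbij, hclosed⟩ := hF.exists_bijOn hD
  set V := D.incidentVerts M.E Z with hV
  set R := D.tailRoots M.E Z with hR
  obtain ⟨a₀, ha₀⟩ := hne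
  have hhead : ∀ a ∈ Z, D.head a ∈ V := fun a ha => ⟨hD.head_notMem a, a, ha, mem_insert _ _⟩
  have hv₀ := hD.head_notMem a₀
  -- Each root at the chosen head outside R yields a pair over V that does not come from Z. These
  -- pairs have distinct second components, so they add |C(head a₀) \ R| ≥ k - r(R) to the |Z| pairs
  -- of Z.
  have hmiss : ∀ r, ∃ x, r ∈ C (D.head a₀) \ R →
      x ∈ V ∧ r ∈ C x ∧ ∀ a ∈ Z, (D.head a, root a) ≠ (x, r) := by
    intro r
    by_contra! hcon
    obtain ⟨hr, hrR⟩ := (hcon (D.head a₀)).1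
    have hrE : r ∈ M.E := (hC _ hv₀).subset_ground hr
    refine hclosed _ hv₀ r hr V (hhead a₀ ha₀) fun x hx hxE hrx => ?_
    obtain ⟨a, ha, hax⟩ := (hcon x).2 hx hrx
    obtain ⟨h1, h2⟩ := Prod.mk.inj hax
    exact ⟨a, hZ ha, h1, h2, fun y hy => ⟨hy.2, a, ha, Or.inr hy.1⟩,
      fun hra => hrR ⟨hrE, a, ha, hra⟩⟩
  choose x hx using hmiss
  have hdisj : Disjoint ((fun a => (D.head a, root a)) '' Z)
      ((fun r => (x r, r)) '' (C (D.head a₀) \ R)) := by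
    rw [Set.disjoint_left]
    rintro _ ⟨a, ha, rfl⟩ ⟨r, hr, har⟩
    exact (hx r hr).2.2 a ha har.symm
  have h1 := ncard_union_eq hdisj
  rw [(hbij.injOn.mono hZ).ncard_image,
    ncard_image_of_injective _ fun r r' h => (Prod.mk.inj h).2] at h1
  have h2 := ncard_sigma_of_forall_ncard_eq V C _ fun v hv => (hC v hv.1).ncard_eq_natRk
  have h3 : ((fun a => (D.head a, root a)) '' Z ∪
      (fun r => (x r, r)) '' (C (D.head a₀) \ R)).ncard ≤
        {p : W × W | p.1 ∈ V ∧ p.2 ∈ C p.1}.ncard := by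
    refine ncard_le_ncard ?_
    rintro _ (⟨a, ha, rfl⟩ | ⟨r, hr, rfl⟩)
    · exact ⟨hhead a ha, (hbij.mapsTo (hZ ha)).2⟩
    · exact ⟨(hx r hr).1, (hx r hr).2.1⟩
  have h4 := ncard_inter_add_ncard_sdiff_eq_ncard (C (D.head a₀)) R
  rw [(hC _ hv₀).ncard_eq_natRk, ← ((hC _ hv₀).indep.inter_right R).natRk_eq_ncard] at h4
  have h5 := MixedHypergraph.natRk_mono M (inter_subset_right : C (D.head a₀) ∩ R ⊆ R)
  omega

/-- A set of dyperedges satisfying the counting conditions is the dyperedge set of a packing. -/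
theorem exists_isMatroidBasedPacking [Finite W] [Finite ι] (hD : D.HasSimpleRoots M.E) (A : Set ι)
    (hcard : ∀ X ⊆ M.Eᶜ, {a | a ∈ A ∧ D.head a ∈ X}.ncard = M.natRk M.E * X.ncard)
    (hA : ∀ Z ⊆ A, Z.Nonempty → Z.ncard + M.natRk M.E ≤
      M.natRk M.E * (D.incidentVerts M.E Z).ncard + M.natRk (D.tailRoots M.E Z)) :
    ∃ F : M.E → Set ι, D.IsMatroidBasedPacking M F ∧ A = ⋃ r, F r := by
  classical
  obtain ⟨B₀, hB₀⟩ := M.exists_isBase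
  -- The value at roots is a device: a base there makes the cut condition trivial for sets meeting
  -- `M.E`, and no dyperedge of `A₀` below touches a root.
  let P : W → Set W := fun v => if v ∈ M.E then B₀ else
    D.tailRoots M.E {a | a ∈ A ∧ D.head a = v}
  have hPE : ∀ v ∈ M.E, P v = B₀ := fun v hv => if_pos hv
  have hPV : ∀ v ∉ M.E, P v = D.tailRoots M.E {a | a ∈ A ∧ D.head a = v} := fun v hv => if_neg hv
  have hP : ∀ v, M.Indep (P v) := by
    intro v
    by_cases hv : v ∈ M.E
    · rw [hPE v hv]; exact hB₀.indep
    · rw [hPV v hv]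
      set R := D.tailRoots M.E {a | a ∈ A ∧ D.head a = v} with hR
      rcases R.eq_empty_or_nonempty with hRe | ⟨r₀, hr₀, a₀, ⟨ha₀, ha₀v⟩, hra₀⟩
      · rw [hRe]; exact M.empty_indep
      let Z : Set ι := {a | a ∈ A ∧ D.head a = v ∧ ∃ r ∈ M.E, r ∈ D.tail a}
      have h1 := hA Z (fun a ha => ha.1) ⟨a₀, ha₀, ha₀v, r₀, hr₀, hra₀⟩
      have h2 : D.incidentVerts M.E Z ⊆ {v} := by
        rintro w ⟨hwE, a, ⟨-, hav, r, hr, hra⟩, hwa⟩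
        rcases hwa with rfl | hwa
        · exact hav
        · rw [hD.tail_eq a r hr hra, mem_singleton_iff] at hwa
          exact absurd (hwa ▸ hr) hwE
      have h3 : D.tailRoots M.E Z ⊆ R := by
        rintro r ⟨hr, a, ha, hra⟩
        exact ⟨hr, a, ⟨ha.1, ha.2.1⟩, hra⟩
      -- Tails containing roots are singletons, so distinct roots need distinct dyperedges and |R| ≤
      -- |Z|. As V_Z lies in {v}, the count gives |Z| ≤ r(R), whence R is independent.
      have h4 : R ⊆ (fun a => (D.tail_nonempty a).some) '' Z := by
        rintro r ⟨hr, a, ⟨ha, hav⟩, hra⟩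
        refine ⟨a, ⟨ha, hav, r, hr, hra⟩, ?_⟩
        have := (D.tail_nonempty a).some_mem
        exact mem_singleton_iff.1 ((hD.tail_eq a r hr hra).subset this)
      have h5 := (ncard_le_ncard h4).trans ncard_image_le
      have h6 := Nat.mul_le_mul_left (M.natRk M.E) (ncard_le_ncard h2)
      rw [ncard_singleton] at h6
      have h7 := MixedHypergraph.natRk_mono M h3
      exact M.indep_of_ncard_le_natRk (by omega)
  let A₀ : Set ι := {a | a ∈ A ∧ Disjoint (D.tail a) M.E}
  have hcover : ∀ X : Set W, X.Nonempty →
      M.natRk M.E ≤ M.natRk (⋃ u ∈ X, P u) + (enteringIn A₀ D.tail D.head X).ncard := by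
    intro X hX
    by_cases hXE : ∃ r ∈ X, r ∈ M.E
    · obtain ⟨r, hrX, hrE⟩ := hXE
      refine le_trans ?_ (Nat.le_add_right _ _)
      rw [← hB₀.ncard_eq_natRk, ← hB₀.indep.natRk_eq_ncard, ← hPE r hrE]
      exact MixedHypergraph.natRk_mono M (subset_biUnion_of_mem hrX)
    push Not at hXE
    have h1 := hcard X hXE
    have hsub : enteringIn A₀ D.tail D.head X ⊆ {a | a ∈ A ∧ D.head a ∈ X} :=
      fun a ha => ⟨ha.1.1, ha.2.1⟩
    have h2 := ncard_sdiff_add_ncard_of_subset hsub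
    -- Of the k|X| dyperedges with head in X, those of Z have all nonroot ends in X and all tail
    -- roots in P(X). The count gives |Z| ≤ k|X| - k + r(P(X)), so the others, which enter X, number
    -- at least k - r(P(X)).
    set Z := {a | a ∈ A ∧ D.head a ∈ X} \ enteringIn A₀ D.tail D.head X with hZ
    have hX1 : 1 ≤ X.ncard := (ncard_pos).2 hX
    have hmul := Nat.mul_le_mul_left (M.natRk M.E) hX1
    rcases Z.eq_empty_or_nonempty with hZe | hZne
    · rw [hZe, ncard_empty] at h2
      omega
    · have h3 := hA Z (fun a ha => ha.1.1) hZne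
      have h4 : D.incidentVerts M.E Z ⊆ X := by
        rintro v ⟨hvE, a, ha, hva⟩
        rcases hva with rfl | hva
        · exact ha.1.2
        · by_contra hvX
          refine ha.2 ⟨⟨ha.1.1, ?_⟩, ha.1.2, v, hva, hvX⟩
          refine Set.disjoint_left.2 fun r hr hrE => hvE ?_
          rw [hD.tail_eq a r hrE hr, mem_singleton_iff] at hva
          rwa [hva]
      have h5 : D.tailRoots M.E Z ⊆ ⋃ u ∈ X, P u := by
        rintro r ⟨hrE, a, ha, hra⟩
        refine mem_biUnion ha.1.2 ?_
        rw [hPV _ (hXE _ ha.1.2)]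
        exact ⟨hrE, a, ⟨ha.1.1, rfl⟩, hra⟩
      have h6 := Nat.mul_le_mul_left (M.natRk M.E) (ncard_le_ncard h4)
      have h7 := MixedHypergraph.natRk_mono M h5
      omega
  obtain ⟨src, hsrc, hcover'⟩ := exists_trimming_covering A₀ D.tail D.head D.tail_nonempty
    (fun X => M.natRk (⋃ u ∈ X, P u)) (natRk_biUnion_submod M P) _ hcover
  obtain ⟨Q, F, hPQ, hQ, hFA, hdisj, hF, huniq, hreach⟩ :=
    exists_growth_to_bases M src D.head A₀ P hP hcover'
  have hsrcE : ∀ a ∈ A₀, src a ∉ M.E := fun a ha => Set.disjoint_left.1 ha.2 (hsrc a)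
  have hsrc_root : ∀ r ∈ M.E, ∀ a, r ∈ D.tail a → src a = r := by
    intro r hr a hra
    have := hsrc a
    rwa [hD.tail_eq a r hr hra, mem_singleton_iff] at this
  have hroot_mem : ∀ r ∈ M.E, ∀ a ∈ A, r ∈ D.tail a → r ∈ P (D.head a) := by
    intro r hr a ha hra
    rw [hPV _ (hD.head_notMem a)]
    exact ⟨hr, a, ⟨ha, rfl⟩, hra⟩
  let F' : M.E → Set ι := fun r => F r ∪ {a | a ∈ A ∧ r.1 ∈ D.tail a}
  let B : M.E → ArcDigraph W ι := fun r =>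
    { verts := insert r.1 {v | v ∉ M.E ∧ r.1 ∈ Q v}
      arcs := F' r
      src := src
      tgt := D.head
      src_mem := by
        rintro a (ha | ⟨ha, hra⟩)
        · exact Or.inr ⟨hsrcE a (hFA r ha), (hF r a ha).1⟩
        · exact Or.inl (hsrc_root r r.2 a hra)
      tgt_mem := by
        rintro a (ha | ⟨ha, hra⟩)
        · exact Or.inr ⟨hD.head_notMem a, (hF r a ha).2.1⟩
        · exact Or.inr ⟨hD.head_notMem a, hPQ _ (hroot_mem r r.2 a ha hra)⟩ }
  have hB : ∀ r, (B r).IsArborescence r := by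
    intro r
    refine ArcDigraph.isArborescence_of_reachable (mem_insert _ _)
      (fun a _ h => hD.head_notMem a (by have := r.2; rwa [← h] at this)) ?_ ?_
    · rintro v (rfl | ⟨hvE, hrv⟩) hvr
      · exact absurd rfl hvr
      by_cases hrP : r.1 ∈ P v
      · obtain ⟨-, a, ⟨ha, hav⟩, hra⟩ := hPV v hvE ▸ hrP
        refine ⟨a, ⟨Or.inr ⟨ha, hra⟩, hav⟩, ?_⟩
        rintro b ⟨hb | ⟨hb, hrb⟩, hbv⟩
        · have hbv' : D.head b = v := hbv
          exact absurd (hbv' ▸ hrP) (hF r b hb).2.2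
        · exact hD.leaving_unique r r.2 b a hrb hra
      · obtain ⟨a, ⟨ha, hav⟩, ha'⟩ := huniq r v hrv hrP
        refine ⟨a, ⟨Or.inl ha, hav⟩, ?_⟩
        rintro b ⟨hb | ⟨hb, hrb⟩, hbv⟩
        · exact ha' b ⟨hb, hbv⟩
        · have hbv' : D.head b = v := hbv
          exact absurd (hbv' ▸ hroot_mem r r.2 b hb hrb) hrP
    · rintro T hrT hT v (rfl | ⟨hvE, hrv⟩)
      · exact hrT
      -- Adding `M.E` absorbs the artificial placements of r at root vertices; v itself is not a
      -- root, so it still lands in T.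
      have := hreach r (T ∪ M.E) ?_ ?_ v hrv
      · exact this.resolve_right hvE
      · intro u hu
        by_cases huE : u ∈ M.E
        · exact Or.inr huE
        · obtain ⟨-, a, ⟨ha, rfl⟩, hra⟩ := hPV u huE ▸ hu
          refine Or.inl (hT a (Or.inr ⟨ha, hra⟩) ?_)
          change src a ∈ T
          rwa [hsrc_root r r.2 a hra]
      · intro a ha haT
        exact Or.inl (hT a (Or.inl ha) (haT.resolve_right (hsrcE a (hFA r ha))))
  have hpack : D.IsMatroidBasedPacking M F' := by
    refine ⟨?_, B, fun r => ⟨⟨rfl, fun a _ => ⟨hsrc a, rfl⟩⟩, hB r⟩, ?_⟩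
    · intro r r' hrr'
      have hne : r.1 ≠ r'.1 := fun h => hrr' (Subtype.ext h)
      refine Set.disjoint_left.2 ?_
      rintro a (ha | ⟨ha, hra⟩) (hb | ⟨hb, hrb⟩)
      · exact Set.disjoint_left.1 (hdisj hne) ha hb
      · exact Set.disjoint_left.1 (hFA _ ha).2 hrb r'.2
      · exact Set.disjoint_left.1 (hFA _ hb).2 hra r.2
      · rw [hD.tail_eq a r r.2 hra, mem_singleton_iff] at hrb
        exact hne hrb.symm
    · intro v hv
      convert hQ v using 1
      ext r
      constructor
      · rintro ⟨hr, rfl | ⟨-, hrv⟩⟩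
        · exact absurd hr hv
        · exact hrv
      · intro hr
        exact ⟨(hQ v).subset_ground hr, Or.inr ⟨hv, hr⟩⟩
  refine ⟨F', hpack, ?_⟩
  -- The packing uses only members of A, and both sets have k|V| elements, so nothing in A is left
  -- over.
  have hall : ∀ A' : Set ι, {a | a ∈ A' ∧ D.head a ∈ M.Eᶜ} = A' := fun A' =>
    Set.ext fun a => and_iff_left (hD.head_notMem a)
  have h1 := hcard _ Subset.rfl
  have h2 := hpack.ncard_head_mem hD Subset.rfl
  rw [hall] at h1 h2
  refine (eq_of_subset_of_ncard_le (iUnion_subset fun r => ?_) (h1.trans h2.symm).le).symm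
  rintro a (ha | ha)
  · exact (hFA _ ha).1
  · exact ha.1

end Dypergraph

/-! ### The directed extension and the extended Tanigawa matroid -/

namespace MixedHypergraph

variable {W ι κ : Type*} (H : MixedHypergraph W ι κ)

theorem mem_ends_map {a : ι ⊕ Σ e : κ, H.edge e} {v : W} :
    v ∈ H.ends (Sum.map id Sigma.fst a) ↔
      v ∈ insert (H.directedExtension.head a) (H.directedExtension.tail a) := by
  rcases a with a | ⟨e, u⟩
  · exact Iff.rfl
  · change v ∈ H.edge e ↔ v ∈ insert u.1 (H.edge e \ {u.1})
    rw [insert_sdiff_singleton, insert_eq_of_mem u.2]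

variable {H}

theorem IsSimplyRooted.notMem_edge {R : Set W} (hH : H.IsSimplyRooted R) {r : W} (hr : r ∈ R)
    (e : κ) : r ∉ H.edge e := by
  intro hre
  have h : e ∈ H.edgesEntering {r} := by
    obtain ⟨w, hw, hne⟩ := (H.edge_nontrivial e).exists_ne r
    exact ⟨⟨r, hre, rfl⟩, w, hw, hne⟩
  rw [(hH r hr).edgesEntering_eq] at h
  exact h

theorem IsSimplyRooted.hasSimpleRoots {R : Set W} (hH : H.IsSimplyRooted R) :
    H.directedExtension.HasSimpleRoots R := by
  have hhead : ∀ a, H.head a ∉ R := by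
    intro a ha
    have h : a ∈ H.entering {H.head a} := by
      obtain ⟨u, hu⟩ := H.tail_nonempty a
      refine ⟨rfl, u, hu, ?_⟩
      rintro rfl
      exact H.head_notMem_tail a hu
    rw [(hH _ ha).entering_eq] at h
    exact h
  have hleave : ∀ r ∈ R, ∀ a, r ∈ H.tail a → a ∈ H.leaving {r} := fun r hr a hra =>
    ⟨fun h => hhead a (by rw [mem_singleton_iff.1 h]; exact hr), r, hra, fun h => h rfl⟩
  refine ⟨?_, ?_, ?_⟩
  · rintro (a | ⟨e, u⟩) h
    · exact hhead a h
    · exact hH.notMem_edge h e u.2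
  · rintro (a | ⟨e, u⟩) r hr hra
    · exact (hH r hr).tail_eq a (hleave r hr a hra)
    · exact absurd hra.1 (hH.notMem_edge hr e)
  · rintro r hr (a | ⟨e, u⟩) (b | ⟨f, w⟩) hra hrb
    · have := encard_le_one_iff.1 (hH r hr).leaving_le a b (hleave r hr a hra) (hleave r hr b hrb)
      rw [this]
    · exact absurd hrb.1 (hH.notMem_edge hr f)
    · exact absurd hra.1 (hH.notMem_edge hr e)
    · exact absurd hra.1 (hH.notMem_edge hr e)

theorem incidentVertices_image (R : Set W) (Z : Set (ι ⊕ Σ e : κ, H.edge e)) :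
    H.incidentVertices R (Sum.map id Sigma.fst '' Z) = H.directedExtension.incidentVerts R Z := by
  ext v
  refine and_congr_right fun _ => ?_
  rw [exists_mem_image]
  exact exists_congr fun a => and_congr_right fun _ => H.mem_ends_map

theorem incidentRoots_image {R : Set W} (hH : H.IsSimplyRooted R)
    (Z : Set (ι ⊕ Σ e : κ, H.edge e)) :
    H.incidentRoots R (Sum.map id Sigma.fst '' Z) = H.directedExtension.tailRoots R Z := by
  ext r
  refine and_congr_right fun hr => ?_
  constructor
  · rintro ⟨a, ⟨b, hb, hba⟩, hra⟩
    rw [← hba, mem_ends_map] at hra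
    refine ⟨b, hb, hra.resolve_left ?_⟩
    rintro rfl
    exact hH.hasSimpleRoots.head_notMem b hr
  · rintro ⟨a | ⟨e, u⟩, ha, hra⟩
    · exact ⟨a, ⟨_, ha, rfl⟩, Or.inr hra⟩
    · exact absurd hra.1 (hH.notMem_edge hr e)

theorem injOn_map_iff {A : Set (ι ⊕ Σ e : κ, H.edge e)} :
    InjOn (Sum.map id Sigma.fst) A ↔ ∀ e, (A ∩ H.bundle e).encard ≤ 1 := by
  simp only [encard_le_one_iff]
  constructor
  · rintro h e _ _ ⟨ha, u, rfl⟩ ⟨hb, w, rfl⟩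
    exact h ha hb rfl
  · rintro h (a | ⟨e, u⟩) ha (b | ⟨f, w⟩) hb hab
    · simpa using hab
    · simp at hab
    · simp at hab
    · obtain rfl : e = f := by simpa using hab
      exact h e _ _ ⟨ha, u, rfl⟩ ⟨hb, w, rfl⟩

/-- Independence in a `comap` requires injectivity, which is exactly the bundle condition.
Injectivity also preserves cardinalities, so the Tanigawa inequalities can be read off in the
directed extension. -/
theorem extendedTanigawaMatroid_indep_iff [Finite W] [Finite ι] [Finite κ] {M : Matroid W}
    (hH : H.IsSimplyRooted M.E) {A : Set (ι ⊕ Σ e : κ, H.edge e)} :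
    (H.extendedTanigawaMatroid M).Indep A ↔
      (∀ Z ⊆ A, Z.Nonempty → Z.ncard + M.natRk M.E ≤
        M.natRk M.E * (H.directedExtension.incidentVerts M.E Z).ncard +
          M.natRk (H.directedExtension.tailRoots M.E Z)) ∧
      ∀ e, (A ∩ H.bundle e).encard ≤ 1 := by
  rw [extendedTanigawaMatroid, Matroid.comap_indep_iff, injOn_map_iff]
  refine and_congr_left fun hinj => ?_
  rw [← injOn_map_iff] at hinj
  have hT : (H.tanigawaMatroid M).Indep (Sum.map id Sigma.fst '' A) ↔
      ∀ Y ⊆ Sum.map id Sigma.fst '' A, Y.Nonempty → (Y.ncard : ℤ) ≤ H.tanigawaFun M Y := Iff.rfl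
  rw [hT]
  rw [forall_subset_image_iff]
  refine forall_congr' fun Z => forall_congr' fun hZ => ?_
  rw [image_nonempty, tanigawaFun, incidentVertices_image, incidentRoots_image hH,
    (hinj.mono hZ).ncard_image]
  refine imp_congr_right fun _ => ?_
  zify
  constructor <;> intro h <;> linarith

end MixedHypergraph

theorem Dypergraph.enteringMatroid_indep_iff {W ι : Type*} [Finite ι] (D : Dypergraph W ι)
    {R : Set W} (hD : ∀ a, D.head a ∉ R) (k : ℕ) {A : Set ι} :
    (D.enteringMatroid R k).Indep A ↔ ∀ v ∉ R, {a | a ∈ A ∧ D.head a = v}.ncard ≤ k := by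
  have hent : ∀ v, D.entering {v} = {a | D.head a = v} := by
    intro v
    refine Set.ext fun a => ⟨fun h => h.1, fun h => ⟨h, ?_⟩⟩
    obtain ⟨u, hu⟩ := D.tail_nonempty a
    refine ⟨u, hu, fun huv => D.head_notMem_tail a ?_⟩
    rwa [show D.head a = v from h, ← mem_singleton_iff.1 huv]
  rw [enteringMatroid, Matroid.disjointSigma_indep_iff]
  constructor
  · intro h v hv
    have := (h.1 ⟨v, hv⟩).2
    change (A ∩ D.entering {v}).ncard ≤ k at this
    rwa [hent] at this
  · refine fun h => ⟨fun v => ⟨inter_subset_right, ?_⟩, fun a _ => ?_⟩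
    · change (A ∩ D.entering {v.1}).ncard ≤ k
      rw [hent]
      exact h v v.2
    · refine mem_iUnion.2 ⟨⟨D.head a, hD a⟩, ?_⟩
      change a ∈ D.entering {D.head a}
      rw [hent]
      rfl

/-- The fibre sizes are bounded by k and sum to k|V|, so every bound is attained. -/
theorem Set.ncard_fiber_mem_eq {α β : Type*} [Finite α] [Finite β] {A : Set α} {f : α → β}
    {V : Set β} {k : ℕ} (hA : ∀ a ∈ A, f a ∈ V) (hle : ∀ v ∈ V, {a | a ∈ A ∧ f a = v}.ncard ≤ k)
    (hcard : A.ncard = k * V.ncard) {X : Set β} (hX : X ⊆ V) :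
    {a | a ∈ A ∧ f a ∈ X}.ncard = k * X.ncard := by
  classical
  have := Fintype.ofFinite β
  have hsum := ncard_eq_sum_ncard_fiber A f V.toFinset (by simpa using hA)
  have heq : ∀ v ∈ V.toFinset, {a | a ∈ A ∧ f a = v}.ncard = k := by
    refine (Finset.sum_eq_sum_iff_of_le (g := fun _ => k) (by simpa using hle)).1 ?_
    rw [← hsum, hcard, Finset.sum_const, ncard_eq_toFinset_card' V, smul_eq_mul, mul_comm]
  rw [ncard_eq_sum_ncard_fiber _ f X.toFinset (fun a ha => by simpa using ha.2),
    Finset.sum_congr rfl (g := fun _ => k), Finset.sum_const, ncard_eq_toFinset_card' X,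
    smul_eq_mul, mul_comm]
  intro v hv
  rw [← heq v (by simpa using hX (by simpa using hv))]
  congr 1
  ext a
  simp only [mem_toFinset] at hv
  simp only [mem_ofPred_eq]
  exact ⟨fun h => ⟨h.1.1, h.2⟩, fun h => ⟨⟨h.1, h.2 ▸ hv⟩, h.2⟩⟩

theorem mainTheorem9 {W ι κ : Type*} [Finite W] [Finite ι] [Finite κ]
    (H : MixedHypergraph W ι κ) (M : Matroid W) (hH : H.IsSimplyRooted M.E)
    (k : ℕ) (hk : k = M.natRk M.E) :
    {A' : Set (ι ⊕ Σ e : κ, H.edge e) | ∃ F : M.E → Set (ι ⊕ Σ e : κ, H.edge e),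
        H.directedExtension.IsMatroidBasedPacking M F ∧ H.IsFeasible F ∧ A' = ⋃ r, F r} =
      {A' : Set (ι ⊕ Σ e : κ, H.edge e) |
        (H.extendedTanigawaMatroid M).Indep A' ∧
        (H.directedExtension.enteringMatroid M.E k).Indep A' ∧
        A'.ncard = k * (M.Eᶜ).ncard} := by
  subst hk
  have hD := hH.hasSimpleRoots
  ext A'
  simp only [mem_ofPred_eq, MixedHypergraph.extendedTanigawaMatroid_indep_iff hH,
    Dypergraph.enteringMatroid_indep_iff _ hD.head_notMem]
  constructor
  · rintro ⟨F, hF, hfeas, rfl⟩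
    refine ⟨⟨fun Z hZ hne => hF.ncard_add_natRk_le hD hZ hne, hfeas⟩, fun v hv => ?_, ?_⟩
    · have := hF.ncard_head_mem hD (X := {v}) (singleton_subset_iff.2 hv)
      rw [ncard_singleton, mul_one] at this
      exact this.le
    · rw [← hF.ncard_head_mem hD Subset.rfl]
      congr 1
      exact Set.ext fun a => (and_iff_left (hD.head_notMem a)).symm
  · rintro ⟨⟨hA, hfeas⟩, hle, hcard⟩
    obtain ⟨F, hF, rfl⟩ := Dypergraph.exists_isMatroidBasedPacking hD A'
      (fun X hX => ncard_fiber_mem_eq (fun a _ => hD.head_notMem a) hle hcard hX) hA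
    exact ⟨F, hF, hfeas, rfl⟩
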